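/- **Lemma (Asymptotics for the three-line problem).** For $\gamma>2$ put $$g_\gamma(k)=\pi\left(2e^{-(2-\frac2\gamma)|k|}+e^{-\frac2\gamma|k|}-e^{-(4-\frac2\gamma)|k|}\right),\quad k\in\mathbb R,$$ $$\theta_\gamma(z)=\frac1{2\pi}\lim_{\epsilon\downarrow0}\int_{|k|\ge\epsilon}\frac{g_\gamma(k)\,(e^{izk}-izk)}{k(\cosh(2k)-1)}\,dk,\quad -1\le \operatorname{Im}z\le 0,$$ $$B_\gamma(z)=\frac{z-z_\gamma}{z-\overline{z_\gamma}},\quad z_\gamma=i\left(2-\tfrac2\gamma\right),\qquad h(z)=h^{(\gamma)}(z)=B_\gamma(z)\,e^{\theta_\gamma(z)},$$ and $h_y(x)=h(x+iy)$ for $x\in\mathbb R$, $-1\le y\le0$. Then for every $\gamma>2$ the limit defining $\theta_\gamma(z)$ exists (with absolutely convergent integrals over $|k|\ge\epsilon$), $h_0$ and $h_{-1}$ are the boundary values of $h$ on the strip $-1<\operatorname{Im}z<0$ (that is, $\int h_y\varphi\to\int h_0\varphi$ as $y\uparrow0$ and $\int h_y\varphi\to\int h_{-1}\varphi$ as $y\downarrow-1$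 for all Schwartz functions $\varphi$), and $h_{-2/\gamma},h_0\in L^\infty(\mathbb R)$, $h_{-1}\in L^2(\mathbb R)$. Moreover $$\lim_{\gamma\downarrow2}\frac{4\pi(\gamma-2)^{\gamma/2}}{\gamma^{\gamma/2}}\,\frac{\|h_{-2/\gamma}\|_{L^\infty(\mathbb R)}^\gamma}{\|h_0\|_{L^\infty(\mathbb R)}^{\gamma-2}\,\|h_{-1}\|_{L^2(\mathbb R)}^2}=1,$$ $$\lim_{\gamma\to\infty}4\pi\,\frac{\|h_{-2/\gamma}\|_{L^\infty(\mathbb R)}^\gamma}{\|h_0\|_{L^\infty(\mathbb R)}^{\gamma-2}\,\|h_{-1}\|_{L^2(\mathbb R)}^2}=V:=4\pi e^2\left(\int_{\mathbb R}\frac{x^2+9}{x^2+1}\,e^{2\operatorname{Re}\theta_\infty(x-i)}\,dx\right)^{-1},$$ where $$\operatorname{Re}\theta_\infty(x-i)=\int_0^\infty\frac{2e^{-2k}-e^{-4k}+1}{k(\cosh(2k)-1)}\bigl(\cos(xk)\sinh(k)-k\bigr)\,dk$$ and the last two integrals converge absolutely. Numerically $V\approx5.342823$, correct to six decimals: $|V-5.342823|<5\cdot10^{-7}$.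 -/

import Mathlib

open Filter Topology MeasureTheory
open scoped ENNReal SchwartzMap

noncomputable section

namespace ThreeLines

/-- The even weight `g_γ`. -/
def weight (γ k : ℝ) : ℝ :=
  Real.pi * (2 * Real.exp (-(2 - 2 / γ) * |k|) + Real.exp (-(2 / γ) * |k|)
    - Real.exp (-(4 - 2 / γ) * |k|))

/-- The integrand `g_γ(k) (e^{izk} - izk) / (k (cosh(2k) - 1))`. -/
def phaseIntegrand (γ : ℝ) (z : ℂ) (k : ℝ) : ℂ :=
  (weight γ k : ℂ) * (Complex.exp (Complex.I * z * k) - Complex.I * z * k) /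
    ((k * (Real.cosh (2 * k) - 1) : ℝ) : ℂ)

/-- `(2π)⁻¹` times the integral over `{k : |k| ≥ ε}`. -/
def truncatedPhase (γ : ℝ) (z : ℂ) (ε : ℝ) : ℂ :=
  (1 / (2 * Real.pi) : ℂ) * ∫ k in {k : ℝ | ε ≤ |k|}, phaseIntegrand γ z k

/-- The phase `θ_γ(z)`: the principal value, i.e. the limit of the truncations as `ε ↓ 0`. -/
def phase (γ : ℝ) (z : ℂ) : ℂ :=
  limUnder (𝓝[>] (0 : ℝ)) (truncatedPhase γ z)

/-- The zero `z_γ = i (2 - 2/γ)` of the Blaschke factor. -/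
def blaschkeZero (γ : ℝ) : ℂ := Complex.I * ((2 - 2 / γ : ℝ) : ℂ)

/-- The Blaschke factor `B_γ` of the upper half plane. -/
def blaschke (γ : ℝ) (z : ℂ) : ℂ :=
  (z - blaschkeZero γ) / (z - (starRingEnd ℂ) (blaschkeZero γ))

/-- The optimizer `h = B_γ e^{θ_γ}`. -/
def optimizer (γ : ℝ) (z : ℂ) : ℂ := blaschke γ z * Complex.exp (phase γ z)

/-- The restriction `h_y(x) = h(x + iy)` of `h` to a horizontal line. -/
def onLine (h : ℂ → ℂ) (y : ℝ) (x : ℝ) : ℂ := h ((x : ℂ) + Complex.I * (y : ℂ))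

/-- `f` is the boundary value, on the line `Im z = y₀`, of the function `h` on the lower strip
`-1 < Im z < 0`: the functions `h_y` converge to `f` as tempered distributions when `y → y₀`
from inside the strip. -/
def IsBoundaryValue (h : ℂ → ℂ) (y₀ : ℝ) (f : ℝ → ℂ) : Prop :=
  ∀ φ : 𝓢(ℝ, ℂ), Tendsto (fun y : ℝ => ∫ x, onLine h y x * φ x)
    (𝓝[Set.Ioo (-1 : ℝ) 0] y₀) (𝓝 (∫ x, f x * φ x))

/-- The `L^p(ℝ)` norm as a real number. -/
def lpNormReal (p : ℝ≥0∞) (f : ℝ → ℂ) : ℝ := (eLpNorm f p volume).toReal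

/-- The three lines ratio
`‖h_{-2/γ}‖_∞^γ / (‖h_0‖_∞^{γ-2} ‖h_{-1}‖_2^2)` of the function `h`. -/
def threeLinesRatio (γ : ℝ) (h : ℂ → ℂ) : ℝ :=
  lpNormReal ∞ (onLine h (-(2 / γ))) ^ γ /
    (lpNormReal ∞ (onLine h 0) ^ (γ - 2) * lpNormReal 2 (onLine h (-1)) ^ 2)

/-- The integrand in the formula for `Re θ_∞(x - i)`. -/
def rePhaseInftyIntegrand (x k : ℝ) : ℝ :=
  (2 * Real.exp (-2 * k) - Real.exp (-4 * k) + 1) / (k * (Real.cosh (2 * k) - 1)) *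
    (Real.cos (x * k) * Real.sinh k - k)

/-- `Re θ_∞(x - i)`. -/
def rePhaseInfty (x : ℝ) : ℝ := ∫ k in Set.Ioi (0 : ℝ), rePhaseInftyIntegrand x k

/-- The integrand `(x² + 9) / (x² + 1) e^{2 Re θ_∞(x - i)}`. -/
def limitIntegrand (x : ℝ) : ℝ :=
  (x ^ 2 + 9) / (x ^ 2 + 1) * Real.exp (2 * rePhaseInfty x)

/-- The limit value `4 π e² (∫ (x² + 9) / (x² + 1) e^{2 Re θ_∞(x - i)} dx)⁻¹`. -/
def limitValue : ℝ := 4 * Real.pi * Real.exp 2 * (∫ x : ℝ, limitIntegrand x)⁻¹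

end ThreeLines

end

/-!
Write `t = 2 / γ`. Folding `k ↦ -k` turns the principal value into the absolutely convergent
integral `θ_γ(z) = i ∫₀^∞ w(k) (sin (z k) - z k) / (k (cosh (2 k) - 1)) dk` with
`w(k) = 2 e^{-(2-t)k} + e^{-tk} - e^{-(4-t)k} > 0`, so that
`Re θ_γ(x - is) = ∫₀^∞ w(k) (cos (x k) sinh (s k) - s k) / (k (cosh (2 k) - 1)) dk`.
For `0 ≤ s ≤ 1` this is maximal at `x = 0`, and so is the modulus of the Blaschke factor. Hence the
sup norms in the ratio are explicit, and only the `L²` norm on `Im z = -1` remains. It converges by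
dominated convergence as `γ → ∞`; as `γ ↓ 2` its square blows up like `1 / (1 - t)`, because after
the rescaling `x = (1 - t) u` the Blaschke factor produces the kernel `1 / (1 + u²)`.

The limit value is elementary. Expanding `1 / sinh` and `1 / sinh²` in exponentials reduces
`Re θ_∞(x - i)` to Frullani integrals; the resulting series are evaluated by Euler's product for
`cosh` and by Stirling's formula. The integrand in `V` becomes `(e⁴ / 4) / cosh² (π x / 2)`, and
`V = 4 π² / e²`.
-/

noncomputable section

namespace ThreeLines

open Set

/-! ### Elementary bounds -/

lemma norm_cos_le (w : ℂ) : ‖Complex.cos w‖ ≤ Real.cosh w.im := by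
  calc ‖Complex.cos w‖
      ≤ (‖Complex.exp (w * Complex.I)‖ + ‖Complex.exp (-w * Complex.I)‖) / 2 := by
        rw [Complex.cos, norm_div, Complex.norm_ofNat]
        gcongr
        exact norm_add_le _ _
    _ = Real.cosh w.im := by
        rw [Complex.norm_exp, Complex.norm_exp, Complex.mul_I_re, Complex.mul_I_re,
          Complex.neg_im, neg_neg, add_comm, Real.cosh_eq]

lemma convex_setOf_abs_im_le (b : ℝ) : Convex ℝ {w : ℂ | |w.im| ≤ b} := by
  simp only [abs_le, ofPred_and]
  exact (convex_halfSpace_im_ge (-b)).inter (convex_halfSpace_im_le b)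

lemma norm_sin_le (w : ℂ) : ‖Complex.sin w‖ ≤ Real.cosh w.im * ‖w‖ := by
  have h := (convex_setOf_abs_im_le |w.im|).norm_image_sub_le_of_norm_deriv_le (f := Complex.sin)
    (C := Real.cosh w.im) (x := 0) (y := w) (fun x _ => Complex.differentiable_sin x)
    (fun x hx => by
      rw [Complex.deriv_sin]
      exact (norm_cos_le x).trans (Real.cosh_le_cosh.2 hx))
    (by simp) (le_refl |w.im|)
  simpa using h

lemma norm_cos_sub_one_le (w : ℂ) : ‖Complex.cos w - 1‖ ≤ Real.cosh w.im * ‖w‖ ^ 2 / 2 := by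
  have half_angle : Complex.cos w - 1 = -2 * Complex.sin (w / 2) ^ 2 := by
    rw [Complex.sin_sq, Complex.cos_sq, mul_div_cancel₀ w two_ne_zero]
    ring
  have cosh_half_sq_le : Real.cosh (w.im / 2) ^ 2 ≤ Real.cosh w.im := by
    have := Real.cosh_two_mul (w.im / 2)
    rw [mul_div_cancel₀ w.im two_ne_zero] at this
    linarith [sq_nonneg (Real.sinh (w.im / 2))]
  have sin_half_le : ‖Complex.sin (w / 2)‖ ≤ Real.cosh (w.im / 2) * (‖w‖ / 2) := by
    simpa using norm_sin_le (w / 2)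
  calc ‖Complex.cos w - 1‖ = 2 * ‖Complex.sin (w / 2)‖ ^ 2 := by
        rw [half_angle, norm_mul, norm_pow, norm_neg, Complex.norm_ofNat]
    _ ≤ 2 * (Real.cosh (w.im / 2) * (‖w‖ / 2)) ^ 2 := by gcongr
    _ = Real.cosh (w.im / 2) ^ 2 * ‖w‖ ^ 2 / 2 := by ring
    _ ≤ Real.cosh w.im * ‖w‖ ^ 2 / 2 := by gcongr

lemma norm_sin_sub_self_le (w : ℂ) : ‖Complex.sin w - w‖ ≤ Real.cosh w.im * ‖w‖ ^ 3 / 2 := by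
  have hconv : Convex ℝ ({x : ℂ | |x.im| ≤ |w.im|} ∩ Metric.closedBall 0 ‖w‖) :=
    (convex_setOf_abs_im_le _).inter (convex_closedBall _ _)
  have hderiv (x : ℂ) : HasDerivAt (fun w => Complex.sin w - w) (Complex.cos x - 1) x :=
    (Complex.hasDerivAt_sin x).sub (hasDerivAt_id x)
  have h := hconv.norm_image_sub_le_of_norm_hasDerivWithin_le (x := 0) (y := w)
    (C := Real.cosh w.im * ‖w‖ ^ 2 / 2) (fun x _ => (hderiv x).hasDerivWithinAt)
    (fun x hx => by
      refine (norm_cos_sub_one_le x).trans ?_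
      have him : Real.cosh x.im ≤ Real.cosh w.im := Real.cosh_le_cosh.2 hx.1
      have hnorm : ‖x‖ ≤ ‖w‖ := mem_closedBall_zero_iff.1 hx.2
      gcongr)
    (by simp) (by simp)
  calc ‖Complex.sin w - w‖ ≤ Real.cosh w.im * ‖w‖ ^ 2 / 2 * ‖w‖ := by simpa using h
    _ = Real.cosh w.im * ‖w‖ ^ 3 / 2 := by ring

lemma cosh_two_mul_sub_one (k : ℝ) : Real.cosh (2 * k) - 1 = 2 * Real.sinh k ^ 2 := by
  rw [Real.cosh_two_mul, Real.cosh_sq]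
  ring

lemma cosh_le_exp {k : ℝ} (hk : 0 ≤ k) : Real.cosh k ≤ Real.exp k := by
  rw [← Real.cosh_add_sinh]
  exact le_add_of_nonneg_right (Real.sinh_nonneg_iff.2 hk)

lemma mul_exp_le_mul_sinh (k : ℝ) : k * Real.exp k ≤ (1 + 2 * k) * Real.sinh k := by
  have h : (1 + 2 * k) * Real.exp (-k) ≤ Real.exp k := by
    calc (1 + 2 * k) * Real.exp (-k) ≤ Real.exp (2 * k) * Real.exp (-k) := by
          gcongr
          linarith [Real.add_one_le_exp (2 * k)]
      _ = Real.exp k := by rw [← Real.exp_add]; ring_nf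
  rw [Real.sinh_eq]
  linarith

lemma sq_mul_exp_le {k : ℝ} (hk : 0 ≤ k) :
    k ^ 2 * Real.exp k ≤ 64 * Real.exp (-(1 / 2) * k) * Real.sinh k ^ 2 := by
  have hlin : 1 + 2 * k ≤ 8 * Real.exp (k / 4) := by linarith [Real.add_one_le_exp (k / 4)]
  have : 0 ≤ Real.sinh k := Real.sinh_nonneg_iff.2 hk
  calc k ^ 2 * Real.exp k = (k * Real.exp k) ^ 2 * Real.exp (-k) := by
        rw [Real.exp_neg]; field_simp
    _ ≤ (8 * Real.exp (k / 4) * Real.sinh k) ^ 2 * Real.exp (-k) := by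
        gcongr ?_ ^ 2 * _
        exact (mul_exp_le_mul_sinh k).trans (by gcongr)
    _ = 64 * (Real.exp (k / 4) * Real.exp (k / 4) * Real.exp (-k)) * Real.sinh k ^ 2 := by ring
    _ = 64 * Real.exp (-(1 / 2) * k) * Real.sinh k ^ 2 := by
        rw [← Real.exp_add, ← Real.exp_add]; ring_nf

/-! ### The phase folded onto the half line -/

/-- The weight `g_γ(k) / π` for `k ≥ 0`, written in terms of `t = 2 / γ`. -/
def halfLineWeight (t k : ℝ) : ℝ :=
  2 * Real.exp (-(2 - t) * k) + Real.exp (-t * k) - Real.exp (-(4 - t) * k)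

lemma weight_of_nonneg (γ : ℝ) {k : ℝ} (hk : 0 ≤ k) :
    weight γ k = Real.pi * halfLineWeight (2 / γ) k := by
  rw [weight, abs_of_nonneg hk, halfLineWeight]

lemma two_mul_exp_neg_le_halfLineWeight (t : ℝ) {k : ℝ} (hk : 0 ≤ k) :
    2 * Real.exp (-k) ≤ halfLineWeight t k := by
  have hexp : Real.exp (-(4 - t) * k) ≤ Real.exp (-(2 - t) * k) := by gcongr; norm_num
  have hfst : Real.exp (-(2 - t) * k) = Real.exp (-(1 - t / 2) * k) ^ 2 := by
    rw [← Real.exp_nat_mul]; push_cast; ring_nf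
  have hsnd : Real.exp (-t * k) = Real.exp (-(t / 2) * k) ^ 2 := by
    rw [← Real.exp_nat_mul]; push_cast; ring_nf
  have hprod : Real.exp (-k) = Real.exp (-(1 - t / 2) * k) * Real.exp (-(t / 2) * k) := by
    rw [← Real.exp_add]; ring_nf
  have amgm := two_mul_le_add_sq (Real.exp (-(1 - t / 2) * k)) (Real.exp (-(t / 2) * k))
  rw [halfLineWeight]
  linarith

lemma halfLineWeight_pos (t : ℝ) {k : ℝ} (hk : 0 ≤ k) : 0 < halfLineWeight t k :=
  (by positivity : (0 : ℝ) < 2 * Real.exp (-k)).trans_le (two_mul_exp_neg_le_halfLineWeight t hk)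

lemma halfLineWeight_le {t k : ℝ} (ht : t ∈ Icc (0 : ℝ) 2) (hk : 0 ≤ k) :
    halfLineWeight t k ≤ 3 := by
  have hfst : Real.exp (-(2 - t) * k) ≤ 1 :=
    Real.exp_le_one_iff.2 (mul_nonpos_of_nonpos_of_nonneg (by linarith [ht.2]) hk)
  have hsnd : Real.exp (-t * k) ≤ 1 :=
    Real.exp_le_one_iff.2 (mul_nonpos_of_nonpos_of_nonneg (by linarith [ht.1]) hk)
  rw [halfLineWeight]
  linarith [Real.exp_pos (-(4 - t) * k)]

/-- The odd part in `k` of the integrand of `θ_γ(z)`, divided by `π i`. -/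
def halfLineIntegrand (t : ℝ) (z : ℂ) (k : ℝ) : ℂ :=
  (halfLineWeight t k : ℂ) * (Complex.sin (z * k) - z * k) /
    ((k * (Real.cosh (2 * k) - 1) : ℝ) : ℂ)

/-- The absolutely convergent integral for which `θ_γ(z) = i * halfLinePhase (2 / γ) z`, by
folding the principal value onto `k > 0`. -/
def halfLinePhase (t : ℝ) (z : ℂ) : ℂ := ∫ k in Ioi (0 : ℝ), halfLineIntegrand t z k

@[fun_prop]
lemma measurable_halfLineIntegrand (t : ℝ) (z : ℂ) : Measurable (halfLineIntegrand t z) := by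
  unfold halfLineIntegrand halfLineWeight
  fun_prop

lemma norm_halfLineIntegrand_le {t : ℝ} {z : ℂ} {k : ℝ} (ht : t ∈ Icc (0 : ℝ) 2)
    (hz : |z.im| ≤ 1) (hk : 0 < k) :
    ‖halfLineIntegrand t z k‖ ≤ 48 * ‖z‖ ^ 3 * Real.exp (-(1 / 2) * k) := by
  have : 0 < Real.sinh k := Real.sinh_pos_iff.2 hk
  have hcosh : Real.cosh (z * k).im ≤ Real.exp k := by
    refine (Real.cosh_le_cosh.2 ?_).trans (cosh_le_exp hk.le)
    rw [Complex.im_mul_ofReal, abs_mul]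
    exact mul_le_of_le_one_left (abs_nonneg k) hz
  have hsin : ‖Complex.sin (z * k) - z * k‖ ≤ Real.exp k * (‖z‖ * k) ^ 3 / 2 := by
    refine (norm_sin_sub_self_le _).trans ?_
    rw [norm_mul, Complex.norm_real, Real.norm_of_nonneg hk.le]
    gcongr
  rw [halfLineIntegrand, norm_div, norm_mul, cosh_two_mul_sub_one, Complex.norm_real,
    Complex.norm_real, Real.norm_of_nonneg (halfLineWeight_pos t hk.le).le,
    Real.norm_of_nonneg (by positivity), div_le_iff₀ (by positivity)]
  calc halfLineWeight t k * ‖Complex.sin (z * k) - z * k‖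
      ≤ 3 * (Real.exp k * (‖z‖ * k) ^ 3 / 2) := by
        gcongr
        exact halfLineWeight_le ht hk.le
    _ = 3 / 2 * ‖z‖ ^ 3 * k * (k ^ 2 * Real.exp k) := by ring
    _ ≤ 3 / 2 * ‖z‖ ^ 3 * k * (64 * Real.exp (-(1 / 2) * k) * Real.sinh k ^ 2) := by
        gcongr ?_ * ?_
        exact sq_mul_exp_le hk.le
    _ = 48 * ‖z‖ ^ 3 * Real.exp (-(1 / 2) * k) * (k * (2 * Real.sinh k ^ 2)) := by ring

lemma integrableOn_const_mul_exp_neg_half (C : ℝ) :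
    IntegrableOn (fun k : ℝ => C * Real.exp (-(1 / 2) * k)) (Ioi 0) :=
  (integrableOn_exp_mul_Ioi (by norm_num) 0).const_mul C

lemma integrableOn_halfLineIntegrand {t : ℝ} {z : ℂ} (ht : t ∈ Icc (0 : ℝ) 2) (hz : |z.im| ≤ 1) :
    IntegrableOn (halfLineIntegrand t z) (Ioi 0) :=
  Integrable.mono' (integrableOn_const_mul_exp_neg_half (48 * ‖z‖ ^ 3))
    (by fun_prop)
    (ae_restrict_of_forall_mem measurableSet_Ioi fun _ => norm_halfLineIntegrand_le ht hz)

lemma norm_halfLinePhase_le {t : ℝ} {z : ℂ} (ht : t ∈ Icc (0 : ℝ) 2) (hz : |z.im| ≤ 1) :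
    ‖halfLinePhase t z‖ ≤ 96 * ‖z‖ ^ 3 := by
  calc ‖halfLinePhase t z‖ ≤ ∫ k in Ioi (0 : ℝ), 48 * ‖z‖ ^ 3 * Real.exp (-(1 / 2) * k) :=
        norm_integral_le_of_norm_le (integrableOn_const_mul_exp_neg_half _)
          (ae_restrict_of_forall_mem measurableSet_Ioi fun _ => norm_halfLineIntegrand_le ht hz)
    _ = 48 * ‖z‖ ^ 3 * 2 := by
        rw [integral_const_mul, integral_exp_mul_Ioi (by norm_num), mul_zero, Real.exp_zero]
        norm_num
    _ = 96 * ‖z‖ ^ 3 := by ring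

lemma continuousOn_halfLinePhase :
    ContinuousOn (fun p : ℝ × ℂ => halfLinePhase p.1 p.2) (Icc 0 2 ×ˢ {z | |z.im| ≤ 1}) := by
  intro p₀ _
  refine continuousWithinAt_of_dominated
    (bound := fun k => 48 * (‖p₀.2‖ + 1) ^ 3 * Real.exp (-(1 / 2) * k))
    (Eventually.of_forall fun p => by fun_prop) ?_ (integrableOn_const_mul_exp_neg_half _)
    (Eventually.of_forall fun k => Continuous.continuousWithinAt ?_)
  · have hbdd : ∀ᶠ p : ℝ × ℂ in 𝓝[Icc 0 2 ×ˢ {z | |z.im| ≤ 1}] p₀, ‖p.2‖ < ‖p₀.2‖ + 1 :=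
      nhdsWithin_le_nhds ((continuous_snd.norm.tendsto p₀).eventually_lt_const (lt_add_one _))
    filter_upwards [hbdd, self_mem_nhdsWithin] with p hp hmem
    refine ae_restrict_of_forall_mem measurableSet_Ioi fun k hk =>
      (norm_halfLineIntegrand_le hmem.1 hmem.2 hk).trans ?_
    gcongr
  · unfold halfLineIntegrand halfLineWeight
    fun_prop

/-- The integrand of `Re θ_γ(x - i s)` over `k > 0`, with `t = 2 / γ`. -/
def rePhaseIntegrand (t s x k : ℝ) : ℝ :=
  halfLineWeight t k * (Real.cos (x * k) * Real.sinh (s * k) - s * k) /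
    (k * (Real.cosh (2 * k) - 1))

/-- `Re θ_γ(x - i s)` as a function of `t = 2 / γ`, which makes sense at `γ = ∞`. -/
def rePhase (t s x : ℝ) : ℝ := ∫ k in Ioi (0 : ℝ), rePhaseIntegrand t s x k

lemma re_I_mul_halfLineIntegrand (t s x k : ℝ) :
    (Complex.I * halfLineIntegrand t (x - Complex.I * s) k).re = rePhaseIntegrand t s x k := by
  have factor : Complex.I * halfLineIntegrand t (x - Complex.I * s) k =
      ((halfLineWeight t k / (k * (Real.cosh (2 * k) - 1)) : ℝ) : ℂ) *
        (Complex.I * (Complex.sin ((x - Complex.I * s) * k) - (x - Complex.I * s) * k)) := by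
    rw [halfLineIntegrand]
    push_cast
    ring
  have cartesian :
      (x - Complex.I * s) * k = ((x * k : ℝ) : ℂ) + ((-(s * k) : ℝ) : ℂ) * Complex.I := by
    push_cast
    ring
  rw [factor, Complex.re_ofReal_mul, cartesian, Complex.sin_add_mul_I, ← Complex.ofReal_sin,
    ← Complex.ofReal_cos, ← Complex.ofReal_sinh, ← Complex.ofReal_cosh, Real.sinh_neg,
    rePhaseIntegrand]
  simp only [Complex.mul_re, Complex.mul_im, Complex.I_re, Complex.I_im, Complex.sub_re,
    Complex.sub_im, Complex.add_re, Complex.add_im, Complex.ofReal_re, Complex.ofReal_im]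
  ring

lemma abs_im_sub_I_mul (x s : ℝ) : |(x - Complex.I * s : ℂ).im| = |s| := by simp

section

variable {t s : ℝ} (ht : t ∈ Icc (0 : ℝ) 2) (hs : |s| ≤ 1)
include ht hs

lemma integrableOn_rePhaseIntegrand (x : ℝ) : IntegrableOn (rePhaseIntegrand t s x) (Ioi 0) := by
  have h := ((integrableOn_halfLineIntegrand (z := x - Complex.I * s) ht
    ((abs_im_sub_I_mul x s).trans_le hs)).const_mul Complex.I).re
  simp only [RCLike.re_eq_complex_re, re_I_mul_halfLineIntegrand] at h
  exact h

lemma re_I_mul_halfLinePhase (x : ℝ) :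
    (Complex.I * halfLinePhase t (x - Complex.I * s)).re = rePhase t s x := by
  have h := integral_re ((integrableOn_halfLineIntegrand (z := x - Complex.I * s) ht
    ((abs_im_sub_I_mul x s).trans_le hs)).const_mul Complex.I)
  simp only [RCLike.re_eq_complex_re, re_I_mul_halfLineIntegrand, integral_const_mul] at h
  exact h.symm

lemma abs_rePhase_zero_le : |rePhase t s 0| ≤ 96 * |s| ^ 3 := by
  have h := norm_halfLinePhase_le (z := (0 : ℝ) - Complex.I * s) ht
    ((abs_im_sub_I_mul 0 s).trans_le hs)
  calc |rePhase t s 0| ≤ ‖Complex.I * halfLinePhase t ((0 : ℝ) - Complex.I * s)‖ := by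
        rw [← re_I_mul_halfLinePhase ht hs]
        exact Complex.abs_re_le_norm _
    _ ≤ 96 * |s| ^ 3 := by simpa using h

end

lemma continuousOn_rePhase :
    ContinuousOn (fun p : ℝ × ℝ × ℝ => rePhase p.1 p.2.1 p.2.2)
      (Icc 0 2 ×ˢ {s | |s| ≤ 1} ×ˢ univ) := by
  have hline : Continuous fun p : ℝ × ℝ × ℝ => (p.1, (p.2.2 - Complex.I * p.2.1 : ℂ)) := by
    fun_prop
  have hmaps : MapsTo (fun p : ℝ × ℝ × ℝ => (p.1, (p.2.2 - Complex.I * p.2.1 : ℂ)))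
      (Icc 0 2 ×ˢ {s | |s| ≤ 1} ×ˢ univ) (Icc 0 2 ×ˢ {z | |z.im| ≤ 1}) := fun p hp =>
    ⟨hp.1, (abs_im_sub_I_mul p.2.2 p.2.1).trans_le hp.2.1⟩
  exact (Complex.continuous_re.comp_continuousOn (continuousOn_const.mul
    (continuousOn_halfLinePhase.comp hline.continuousOn hmaps))).congr fun p hp =>
      (re_I_mul_halfLinePhase hp.1 hp.2.1 p.2.2).symm

lemma rePhase_le_rePhase_zero {t s : ℝ} (ht : t ∈ Icc (0 : ℝ) 2) (hs : s ∈ Icc (0 : ℝ) 1)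
    (x : ℝ) : rePhase t s x ≤ rePhase t s 0 := by
  have hs' : |s| ≤ 1 := (abs_of_nonneg hs.1).trans_le hs.2
  refine setIntegral_mono_on (integrableOn_rePhaseIntegrand ht hs' x)
    (integrableOn_rePhaseIntegrand ht hs' 0) measurableSet_Ioi fun k (hk : 0 < k) => ?_
  have hweight := halfLineWeight_pos t hk.le
  have hsinh : 0 ≤ Real.sinh (s * k) := Real.sinh_nonneg_iff.2 (mul_nonneg hs.1 hk.le)
  have hcos : Real.cos (x * k) ≤ Real.cos (0 * k) := by
    simpa only [zero_mul, Real.cos_zero] using Real.cos_le_one (x * k)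
  rw [rePhaseIntegrand, rePhaseIntegrand, cosh_two_mul_sub_one]
  gcongr

lemma rePhaseInftyIntegrand_eq (x k : ℝ) :
    rePhaseInftyIntegrand x k = rePhaseIntegrand 0 1 x k := by
  simp only [rePhaseInftyIntegrand, rePhaseIntegrand, halfLineWeight, sub_zero, neg_zero,
    zero_mul, Real.exp_zero, one_mul]
  ring

lemma rePhaseInfty_eq (x : ℝ) : rePhaseInfty x = rePhase 0 1 x := by
  simp only [rePhaseInfty, rePhase, rePhaseInftyIntegrand_eq]

lemma integrableOn_rePhaseInftyIntegrand (x : ℝ) :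
    IntegrableOn (rePhaseInftyIntegrand x) (Ioi 0) := by
  simpa only [funext (rePhaseInftyIntegrand_eq x)] using
    integrableOn_rePhaseIntegrand (t := 0) (s := 1) (by simp) (by simp) x

/-! ### Frullani integrals -/

lemma norm_cexp_sub_cexp_le {u v : ℂ} {b : ℝ} (hu : u.re ≤ b) (hv : v.re ≤ b) :
    ‖Complex.exp u - Complex.exp v‖ ≤ Real.exp b * ‖u - v‖ := by
  refine (convex_halfSpace_re_le b).norm_image_sub_le_of_norm_deriv_le (f := Complex.exp)
    (fun x _ => Complex.differentiable_exp x) (fun x hx => ?_) hv hu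
  rw [Complex.deriv_exp, Complex.norm_exp]
  exact Real.exp_le_exp.2 hx

/-- The integrand `(e^{-ak} - e^{-ck}) / k` of the complex Frullani integral. -/
def frullaniIntegrand (c a : ℂ) (k : ℝ) : ℂ :=
  (Complex.exp (-(a * k)) - Complex.exp (-(c * k))) / k

@[fun_prop]
lemma measurable_frullaniIntegrand (c a : ℂ) : Measurable (frullaniIntegrand c a) := by
  unfold frullaniIntegrand
  fun_prop

lemma norm_frullaniIntegrand_le (c a : ℂ) {k : ℝ} (hk : 0 < k) :
    ‖frullaniIntegrand c a k‖ ≤ ‖a - c‖ * Real.exp (-min a.re c.re * k) := by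
  have hre {w : ℂ} (hw : min a.re c.re ≤ w.re) : (-(w * k)).re ≤ -min a.re c.re * k := by
    rw [Complex.neg_re, Complex.re_mul_ofReal, ← neg_mul]
    gcongr
  rw [frullaniIntegrand, norm_div, Complex.norm_real, Real.norm_of_nonneg hk.le, div_le_iff₀ hk]
  calc ‖Complex.exp (-(a * k)) - Complex.exp (-(c * k))‖
      ≤ Real.exp (-min a.re c.re * k) * ‖-(a * k) - -(c * k)‖ :=
        norm_cexp_sub_cexp_le (hre (min_le_left _ _)) (hre (min_le_right _ _))
    _ = ‖a - c‖ * Real.exp (-min a.re c.re * k) * k := by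
        rw [show -(a * k) - -(c * k) = -(a - c) * (k : ℂ) by ring, norm_mul, norm_neg,
          Complex.norm_real, Real.norm_of_nonneg hk.le]
        ring

lemma integrableOn_frullaniIntegrand {c a : ℂ} (hc : 0 < c.re) (ha : 0 < a.re) :
    IntegrableOn (frullaniIntegrand c a) (Ioi 0) :=
  Integrable.mono' ((integrableOn_exp_mul_Ioi (neg_lt_zero.2 (lt_min ha hc)) 0).const_mul ‖a - c‖)
    (by fun_prop)
    (ae_restrict_of_forall_mem measurableSet_Ioi fun _ => norm_frullaniIntegrand_le c a)

lemma hasDerivAt_frullaniIntegrand (c a : ℂ) {k : ℝ} (hk : k ≠ 0) :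
    HasDerivAt (fun a => frullaniIntegrand c a k) (-Complex.exp (-(a * k))) a := by
  have hk' : (k : ℂ) ≠ 0 := by exact_mod_cast hk
  have h := (((hasDerivAt_id a).mul_const (k : ℂ)).neg.cexp.sub_const
    (Complex.exp (-(c * k)))).div_const (k : ℂ)
  have hderiv : -Complex.exp (-(a * k)) = Complex.exp (-(a * k)) * -(1 * k) / k := by field_simp
  exact hderiv ▸ h

lemma half_re_le_re_of_mem_ball {a w : ℂ} (hw : w ∈ Metric.ball a (a.re / 2)) :
    a.re / 2 ≤ w.re := by
  have h : |(w - a).re| < a.re / 2 := (Complex.abs_re_le_norm _).trans_lt (mem_ball_iff_norm.1 hw)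
  rw [Complex.sub_re] at h
  linarith [(abs_lt.1 h).1]

lemma hasDerivAt_integral_frullaniIntegrand {c a : ℂ} (hc : 0 < c.re) (ha : 0 < a.re) :
    HasDerivAt (fun a => ∫ k in Ioi (0 : ℝ), frullaniIntegrand c a k) (-a⁻¹) a := by
  have h := hasDerivAt_integral_of_dominated_loc_of_deriv_le
    (μ := volume.restrict (Ioi (0 : ℝ)))
    (F := frullaniIntegrand c) (F' := fun a k => -Complex.exp (-(a * k))) (x₀ := a)
    (s := Metric.ball a (a.re / 2)) (bound := fun k => Real.exp (-(a.re / 2) * k))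
    (Metric.ball_mem_nhds a (half_pos ha))
    (Eventually.of_forall fun w => by fun_prop)
    (integrableOn_frullaniIntegrand hc ha)
    (Measurable.aestronglyMeasurable (by fun_prop))
    (ae_restrict_of_forall_mem measurableSet_Ioi fun k (hk : 0 < k) w hw => by
      rw [norm_neg, Complex.norm_exp, Complex.neg_re, Complex.re_mul_ofReal, neg_mul]
      gcongr
      exact half_re_le_re_of_mem_ball hw)
    (integrableOn_exp_mul_Ioi (neg_lt_zero.2 (half_pos ha)) 0)
    (ae_restrict_of_forall_mem measurableSet_Ioi fun k (hk : 0 < k) w _ =>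
      hasDerivAt_frullaniIntegrand c w hk.ne')
  have hint : ∫ k in Ioi (0 : ℝ), -Complex.exp (-(a * k)) = -a⁻¹ := by
    have := integral_exp_mul_complex_Ioi (a := -a) (by simpa using ha) 0
    simp only [neg_mul, Complex.ofReal_zero, mul_zero, Complex.exp_zero] at this
    rw [integral_neg, this, neg_div_neg_eq, one_div]
  exact hint ▸ h.2

lemma integral_frullaniIntegrand {c a : ℂ} (hc : 0 < c.re) (ha : 0 < a.re) :
    ∫ k in Ioi (0 : ℝ), frullaniIntegrand c a k = Complex.log c - Complex.log a := by
  have hderiv : ∀ w ∈ {w : ℂ | 0 < w.re}, HasDerivAt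
      (fun w => (∫ k in Ioi (0 : ℝ), frullaniIntegrand c w k) + Complex.log w) 0 w :=
    fun w hw => neg_add_cancel w⁻¹ ▸
      (hasDerivAt_integral_frullaniIntegrand hc hw).add (Complex.hasDerivAt_log (Or.inl hw))
  have hconst := (isOpen_lt continuous_const Complex.continuous_re).is_const_of_deriv_eq_zero
    (convex_halfSpace_re_gt 0).isPreconnected
    (fun w hw => (hderiv w hw).differentiableAt.differentiableWithinAt)
    (fun w hw => (hderiv w hw).deriv) ha hc
  have hdiag : ∫ k in Ioi (0 : ℝ), frullaniIntegrand c c k = 0 := by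
    simp only [frullaniIntegrand, sub_self, zero_div, integral_zero]
  rw [hdiag, zero_add] at hconst
  exact eq_sub_of_add_eq hconst

lemma exp_mul_sinh_div_sub_one_eq (m : ℝ) {k : ℝ} (hk : k ≠ 0) :
    Real.exp (-m * k) * (Real.sinh k / k - 1) =
      (1 / 2) * (frullaniIntegrand (m + 1 : ℝ) (m - 1 : ℝ) k).re - Real.exp (-m * k) := by
  have hreal : frullaniIntegrand (m + 1 : ℝ) (m - 1 : ℝ) k =
      (((Real.exp (-((m - 1) * k)) - Real.exp (-((m + 1) * k))) / k : ℝ) : ℂ) := by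
    rw [frullaniIntegrand]
    push_cast
    rfl
  rw [hreal, Complex.ofReal_re, Real.sinh_eq,
    show -((m - 1) * k) = -m * k + k by ring, show -((m + 1) * k) = -m * k + -k by ring,
    Real.exp_add, Real.exp_add]
  field_simp

section

variable {m : ℝ} (hm : 1 < m)
include hm

lemma integrableOn_exp_mul_sinh_div_sub_one :
    IntegrableOn (fun k => Real.exp (-m * k) * (Real.sinh k / k - 1)) (Ioi 0) := by
  have hfrullani := (integrableOn_frullaniIntegrand (c := (m + 1 : ℝ)) (a := (m - 1 : ℝ))
    (by rw [Complex.ofReal_re]; linarith) (by rw [Complex.ofReal_re]; linarith)).re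
  exact IntegrableOn.congr_fun ((hfrullani.const_mul (1 / 2)).sub
    (integrableOn_exp_mul_Ioi (a := -m) (by linarith) 0))
      (fun k hk => (exp_mul_sinh_div_sub_one_eq m (ne_of_gt hk)).symm) measurableSet_Ioi

lemma integral_exp_mul_sinh_div_sub_one :
    ∫ k in Ioi (0 : ℝ), Real.exp (-m * k) * (Real.sinh k / k - 1) =
      (Real.log (m + 1) - Real.log (m - 1)) / 2 - 1 / m := by
  have hc : 0 < ((m + 1 : ℝ) : ℂ).re := by rw [Complex.ofReal_re]; linarith
  have ha : 0 < ((m - 1 : ℝ) : ℂ).re := by rw [Complex.ofReal_re]; linarith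
  have hfrullani := integrableOn_frullaniIntegrand hc ha
  have hre := integral_re hfrullani
  have hint := hfrullani.re
  simp only [RCLike.re_eq_complex_re] at hre hint
  rw [setIntegral_congr_fun measurableSet_Ioi
      fun k hk => exp_mul_sinh_div_sub_one_eq m (ne_of_gt hk),
    integral_sub (hint.const_mul (1 / 2)) (integrableOn_exp_mul_Ioi (by linarith) 0),
    integral_const_mul, hre, integral_frullaniIntegrand hc ha, integral_exp_mul_Ioi (by linarith),
    Complex.sub_re, Complex.log_ofReal_re, Complex.log_ofReal_re, mul_zero, Real.exp_zero,
    neg_div_neg_eq]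
  ring

end

lemma exp_mul_one_sub_cos_div_eq (c x k : ℝ) :
    Real.exp (-c * k) * ((1 - Real.cos (x * k)) / k) =
      -(frullaniIntegrand c (c - x * Complex.I) k).re := by
  rw [frullaniIntegrand, Complex.div_ofReal_re, Complex.sub_re, Complex.exp_re, Complex.exp_re]
  simp only [Complex.neg_re, Complex.neg_im, Complex.re_mul_ofReal, Complex.im_mul_ofReal,
    Complex.sub_re, Complex.sub_im, Complex.ofReal_re, Complex.ofReal_im, Complex.mul_I_re,
    Complex.mul_I_im, neg_zero, sub_zero, zero_sub, neg_mul, neg_neg, zero_mul, Real.cos_zero,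
    mul_one]
  ring

section

variable {c : ℝ} (hc : 0 < c) (x : ℝ)
include hc

lemma integrableOn_exp_mul_one_sub_cos_div :
    IntegrableOn (fun k => Real.exp (-c * k) * ((1 - Real.cos (x * k)) / k)) (Ioi 0) := by
  simp only [exp_mul_one_sub_cos_div_eq]
  exact (integrableOn_frullaniIntegrand (by simpa using hc) (by simpa using hc)).re.neg

lemma integral_exp_mul_one_sub_cos_div :
    ∫ k in Ioi (0 : ℝ), Real.exp (-c * k) * ((1 - Real.cos (x * k)) / k) =
      Real.log (1 + x ^ 2 / c ^ 2) / 2 := by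
  have hc' : 0 < (c : ℂ).re := by simpa using hc
  have ha : 0 < (c - x * Complex.I : ℂ).re := by simpa using hc
  have hre := integral_re (integrableOn_frullaniIntegrand hc' ha)
  simp only [RCLike.re_eq_complex_re] at hre
  have hnorm : ‖(c - x * Complex.I : ℂ)‖ = √(c ^ 2 + x ^ 2) := by
    rw [sub_eq_add_neg, ← neg_mul, ← Complex.ofReal_neg, Complex.norm_add_mul_I, neg_sq]
  simp only [exp_mul_one_sub_cos_div_eq]
  rw [integral_neg, hre, integral_frullaniIntegrand hc' ha, Complex.sub_re, Complex.log_ofReal_re,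
    Complex.log_re, hnorm, Real.log_sqrt (by positivity),
    show 1 + x ^ 2 / c ^ 2 = (c ^ 2 + x ^ 2) / c ^ 2 by field_simp,
    Real.log_div (by positivity) (by positivity), Real.log_pow]
  push_cast
  ring

end

/-! ### Decay on the line `Im z = -1` -/

lemma rePhaseIntegrand_one_zero_sub (t x : ℝ) {k : ℝ} (hk : 0 < k) :
    rePhaseIntegrand t 1 0 k - rePhaseIntegrand t 1 x k =
      halfLineWeight t k / (2 * Real.sinh k) * ((1 - Real.cos (x * k)) / k) := by
  have : 0 < Real.sinh k := Real.sinh_pos_iff.2 hk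
  simp only [rePhaseIntegrand, cosh_two_mul_sub_one, one_mul, zero_mul, Real.cos_zero]
  field_simp
  ring

lemma one_sub_cos_div_nonneg (x : ℝ) {k : ℝ} (hk : 0 ≤ k) : 0 ≤ (1 - Real.cos (x * k)) / k :=
  div_nonneg (sub_nonneg.2 (Real.cos_le_one _)) hk

lemma two_mul_exp_le_halfLineWeight_div (t : ℝ) {k : ℝ} (hk : 0 < k) :
    2 * Real.exp (-2 * k) ≤ halfLineWeight t k / (2 * Real.sinh k) := by
  have : 0 < Real.sinh k := Real.sinh_pos_iff.2 hk
  rw [le_div_iff₀ (by positivity)]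
  calc 2 * Real.exp (-2 * k) * (2 * Real.sinh k)
      = 2 * (Real.exp (-2 * k) * Real.exp k) - 2 * (Real.exp (-2 * k) * Real.exp (-k)) := by
        rw [Real.sinh_eq]
        ring
    _ ≤ 2 * (Real.exp (-2 * k) * Real.exp k) := sub_le_self _ (by positivity)
    _ = 2 * Real.exp (-k) := by
        rw [← Real.exp_add]
        ring_nf
    _ ≤ halfLineWeight t k := two_mul_exp_neg_le_halfLineWeight t hk.le

section

variable {t : ℝ} (ht : t ∈ Icc (0 : ℝ) 2)
include ht

lemma integrableOn_halfLineWeight_div_mul_one_sub_cos (x : ℝ) :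
    IntegrableOn (fun k => halfLineWeight t k / (2 * Real.sinh k) * ((1 - Real.cos (x * k)) / k))
      (Ioi 0) :=
  ((integrableOn_rePhaseIntegrand ht (by simp) 0).sub
    (integrableOn_rePhaseIntegrand ht (by simp) x)).congr_fun
      (fun _ => rePhaseIntegrand_one_zero_sub t x) measurableSet_Ioi

lemma rePhase_one_zero_sub (x : ℝ) :
    rePhase t 1 0 - rePhase t 1 x =
      ∫ k in Ioi (0 : ℝ),
        halfLineWeight t k / (2 * Real.sinh k) * ((1 - Real.cos (x * k)) / k) := by
  rw [rePhase, rePhase, ← integral_sub (integrableOn_rePhaseIntegrand ht (by simp) 0)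
    (integrableOn_rePhaseIntegrand ht (by simp) x)]
  exact setIntegral_congr_fun measurableSet_Ioi fun _ => rePhaseIntegrand_one_zero_sub t x

lemma rePhase_one_le (x : ℝ) : rePhase t 1 x ≤ 96 - Real.log (1 + x ^ 2 / 4) := by
  have hzero : rePhase t 1 0 ≤ 96 := by
    simpa using (abs_le.1 (abs_rePhase_zero_le ht (s := 1) (by simp))).2
  have hlog : Real.log (1 + x ^ 2 / 4) ≤ rePhase t 1 0 - rePhase t 1 x := by
    calc Real.log (1 + x ^ 2 / 4)
        = ∫ k in Ioi (0 : ℝ), 2 * (Real.exp (-2 * k) * ((1 - Real.cos (x * k)) / k)) := by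
          rw [integral_const_mul, integral_exp_mul_one_sub_cos_div two_pos]
          ring_nf
      _ ≤ ∫ k in Ioi (0 : ℝ),
            halfLineWeight t k / (2 * Real.sinh k) * ((1 - Real.cos (x * k)) / k) := by
          refine setIntegral_mono_on
            ((integrableOn_exp_mul_one_sub_cos_div two_pos x).const_mul 2)
            (integrableOn_halfLineWeight_div_mul_one_sub_cos ht x) measurableSet_Ioi
            fun k (hk : 0 < k) => ?_
          rw [← mul_assoc]
          exact mul_le_mul_of_nonneg_right (two_mul_exp_le_halfLineWeight_div t hk)
            (one_sub_cos_div_nonneg x hk.le)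
      _ = rePhase t 1 0 - rePhase t 1 x := (rePhase_one_zero_sub ht x).symm
  linarith

lemma exp_two_mul_rePhase_one_le (x : ℝ) :
    Real.exp (2 * rePhase t 1 x) ≤ Real.exp 192 / (1 + x ^ 2 / 4) ^ 2 := by
  calc Real.exp (2 * rePhase t 1 x) ≤ Real.exp (192 - (2 : ℕ) * Real.log (1 + x ^ 2 / 4)) := by
        gcongr
        push_cast
        linarith [rePhase_one_le ht x]
    _ = Real.exp 192 / (1 + x ^ 2 / 4) ^ 2 := by
        rw [Real.exp_sub, Real.exp_nat_mul, Real.exp_log (by positivity)]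

end

/-! ### The principal value -/

lemma two_div_mem_Icc {γ : ℝ} (hγ : 1 ≤ γ) : 2 / γ ∈ Icc (0 : ℝ) 2 :=
  ⟨by positivity, div_le_self zero_le_two hγ⟩

@[fun_prop]
lemma measurable_phaseIntegrand (γ : ℝ) (z : ℂ) : Measurable (phaseIntegrand γ z) := by
  unfold phaseIntegrand weight
  fun_prop

lemma phaseIntegrand_neg (γ : ℝ) (z : ℂ) (k : ℝ) :
    phaseIntegrand γ z (-k) = -phaseIntegrand γ (-z) k := by
  simp only [phaseIntegrand, weight, abs_neg, Complex.ofReal_neg, mul_neg 2 k, mul_neg,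
    Real.cosh_neg, neg_mul, div_neg]

lemma phaseIntegrand_sub_neg (γ : ℝ) (z : ℂ) {k : ℝ} (hk : 0 ≤ k) :
    phaseIntegrand γ z k - phaseIntegrand γ (-z) k =
      2 * Real.pi * Complex.I * halfLineIntegrand (2 / γ) z k := by
  have hpos : Complex.I * z * k = z * k * Complex.I := by ring
  have hneg : Complex.I * -z * k = -(z * k) * Complex.I := by ring
  simp only [phaseIntegrand, halfLineIntegrand, weight_of_nonneg γ hk, Complex.sin, hpos, hneg,
    Complex.ofReal_mul]
  linear_combination Real.pi * halfLineWeight (2 / γ) k / (k * ((Real.cosh (2 * k) - 1 : ℝ) : ℂ)) *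
    (Complex.exp (z * k * Complex.I) - Complex.exp (-(z * k) * Complex.I)) * Complex.I_sq

lemma setIntegral_phaseIntegrand_Iic_neg (γ : ℝ) (z : ℂ) (ε : ℝ) :
    ∫ k in Iic (-ε), phaseIntegrand γ z k = -∫ k in Ioi ε, phaseIntegrand γ (-z) k := by
  rw [← integral_neg, ← neg_neg ε, ← integral_comp_neg_Iic, neg_neg]
  simp only [← phaseIntegrand_neg, neg_neg]

lemma setOf_le_abs (ε : ℝ) : {k : ℝ | ε ≤ |k|} = Iic (-ε) ∪ Ici ε :=
  Set.ext fun k => (le_abs' : ε ≤ |k| ↔ _)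

section

variable {γ : ℝ} (hγ : 1 ≤ γ) {z : ℂ} (hz : |z.im| ≤ 1)

include hz in
lemma norm_cexp_sub_self_le {k : ℝ} (hk : 0 ≤ k) :
    ‖Complex.exp (Complex.I * z * k) - Complex.I * z * k‖ ≤ (1 + ‖z‖) * Real.exp k := by
  have hexp : ‖Complex.exp (Complex.I * z * k)‖ ≤ Real.exp k := by
    rw [Complex.norm_exp, Complex.re_mul_ofReal, Complex.I_mul_re]
    gcongr
    exact mul_le_of_le_one_left hk ((neg_le_abs _).trans hz)
  have hlin : ‖Complex.I * z * k‖ ≤ ‖z‖ * Real.exp k := by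
    rw [norm_mul, norm_mul, Complex.norm_I, one_mul, Complex.norm_real, Real.norm_of_nonneg hk]
    gcongr
    linarith [Real.add_one_le_exp k]
  calc ‖Complex.exp (Complex.I * z * k) - Complex.I * z * k‖
      ≤ Real.exp k + ‖z‖ * Real.exp k := (norm_sub_le _ _).trans (add_le_add hexp hlin)
    _ = (1 + ‖z‖) * Real.exp k := by ring

include hγ hz

lemma norm_phaseIntegrand_le {k : ℝ} (hk : 0 < k) :
    ‖phaseIntegrand γ z k‖ ≤ 96 * Real.pi * (1 + ‖z‖) / k ^ 3 * Real.exp (-(1 / 2) * k) := by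
  have : 0 < Real.sinh k := Real.sinh_pos_iff.2 hk
  have hweight := halfLineWeight_pos (2 / γ) hk.le
  rw [phaseIntegrand, norm_div, norm_mul, Complex.norm_real, Complex.norm_real,
    weight_of_nonneg γ hk.le, cosh_two_mul_sub_one, Real.norm_of_nonneg (by positivity),
    Real.norm_of_nonneg (by positivity), div_le_iff₀ (by positivity)]
  calc Real.pi * halfLineWeight (2 / γ) k *
        ‖Complex.exp (Complex.I * z * k) - Complex.I * z * k‖
      ≤ Real.pi * 3 * ((1 + ‖z‖) * Real.exp k) := by
        gcongr
        · exact halfLineWeight_le (two_div_mem_Icc hγ) hk.le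
        · exact norm_cexp_sub_self_le hz hk.le
    _ = 3 * Real.pi * (1 + ‖z‖) / k ^ 2 * (k ^ 2 * Real.exp k) := by field_simp
    _ ≤ 3 * Real.pi * (1 + ‖z‖) / k ^ 2 *
        (64 * Real.exp (-(1 / 2) * k) * Real.sinh k ^ 2) := by
        gcongr ?_ * ?_
        exact sq_mul_exp_le hk.le
    _ = 96 * Real.pi * (1 + ‖z‖) / k ^ 3 * Real.exp (-(1 / 2) * k) *
        (k * (2 * Real.sinh k ^ 2)) := by
        field_simp
        norm_num

variable {ε : ℝ} (hε : 0 < ε)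
include hε

lemma integrableOn_phaseIntegrand_Ici : IntegrableOn (phaseIntegrand γ z) (Ici ε) := by
  have hbound := ((integrableOn_const_mul_exp_neg_half
    (96 * Real.pi * (1 + ‖z‖) / ε ^ 3)).mono_set (Ici_subset_Ioi.2 hε))
  refine Integrable.mono' hbound (by fun_prop)
    (ae_restrict_of_forall_mem measurableSet_Ici fun k (hk : ε ≤ k) => ?_)
  refine (norm_phaseIntegrand_le hγ hz (hε.trans_le hk)).trans ?_
  gcongr

lemma integrableOn_phaseIntegrand_Iic : IntegrableOn (phaseIntegrand γ z) (Iic (-ε)) := by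
  have h := (integrableOn_phaseIntegrand_Ici hγ (z := -z) (by simpa using hz) hε).neg
  simpa only [Pi.neg_def, ← phaseIntegrand_neg, neg_neg] using
    IntegrableOn.comp_neg_Iic (c := -ε) (f := -phaseIntegrand γ (-z)) (by rwa [neg_neg])

lemma integrableOn_phaseIntegrand : IntegrableOn (phaseIntegrand γ z) {k : ℝ | ε ≤ |k|} := by
  rw [setOf_le_abs]
  exact (integrableOn_phaseIntegrand_Iic hγ hz hε).union (integrableOn_phaseIntegrand_Ici hγ hz hε)

lemma truncatedPhase_eq :
    truncatedPhase γ z ε = Complex.I * ∫ k in Ioi ε, halfLineIntegrand (2 / γ) z k := by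
  have hdisj : Disjoint (Iic (-ε)) (Ici ε) := Iic_disjoint_Ici.2 (by linarith)
  have hIoi {w : ℂ} (hw : |w.im| ≤ 1) : IntegrableOn (phaseIntegrand γ w) (Ioi ε) :=
    (integrableOn_phaseIntegrand_Ici hγ hw hε).mono_set Ioi_subset_Ici_self
  have hpi : (Real.pi : ℂ) ≠ 0 := by exact_mod_cast Real.pi_ne_zero
  rw [truncatedPhase, setOf_le_abs, setIntegral_union hdisj measurableSet_Ici
      (integrableOn_phaseIntegrand_Iic hγ hz hε) (integrableOn_phaseIntegrand_Ici hγ hz hε),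
    integral_Ici_eq_integral_Ioi, setIntegral_phaseIntegrand_Iic_neg, neg_add_eq_sub,
    ← integral_sub (hIoi hz) (hIoi (by simpa using hz)),
    setIntegral_congr_fun measurableSet_Ioi
      fun k hk => phaseIntegrand_sub_neg γ z (hε.trans hk).le, integral_const_mul]
  field_simp

omit hε

lemma tendsto_truncatedPhase_halfLinePhase :
    Tendsto (truncatedPhase γ z) (𝓝[>] (0 : ℝ)) (𝓝 (Complex.I * halfLinePhase (2 / γ) z)) := by
  have hcover : AECover (volume.restrict (Ioi (0 : ℝ))) (𝓝[>] (0 : ℝ)) fun ε : ℝ => Ioi ε :=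
    aecover_Ioi_of_Ioi (tendsto_id.mono_left nhdsWithin_le_nhds)
  refine ((hcover.integral_tendsto_of_countably_generated
    (integrableOn_halfLineIntegrand (two_div_mem_Icc hγ) hz)).const_mul Complex.I).congr' ?_
  filter_upwards [self_mem_nhdsWithin] with ε (hε : 0 < ε)
  rw [truncatedPhase_eq hγ hz hε, Measure.restrict_restrict measurableSet_Ioi,
    Ioi_inter_Ioi, max_eq_left hε.le]

lemma phase_eq : phase γ z = Complex.I * halfLinePhase (2 / γ) z :=
  (tendsto_truncatedPhase_halfLinePhase hγ hz).limUnder_eq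

lemma tendsto_truncatedPhase :
    Tendsto (truncatedPhase γ z) (𝓝[>] (0 : ℝ)) (𝓝 (phase γ z)) := by
  rw [phase_eq hγ hz]
  exact tendsto_truncatedPhase_halfLinePhase hγ hz

end

/-! ### The optimizer on horizontal lines -/

/-- `|h(x - i s)|²` as a function of `t = 2 / γ`, which makes sense at `γ = ∞`. -/
def normSqOnLine (t s x : ℝ) : ℝ :=
  (x ^ 2 + (2 - t + s) ^ 2) / (x ^ 2 + (2 - t - s) ^ 2) * Real.exp (2 * rePhase t s x)

lemma normSqOnLine_nonneg (t s x : ℝ) : 0 ≤ normSqOnLine t s x := by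
  unfold normSqOnLine; positivity

lemma normSqOnLine_le_normSqOnLine_zero {t s : ℝ} (ht : t ∈ Ico (0 : ℝ) 1)
    (hs : s ∈ Icc (0 : ℝ) 1) (x : ℝ) : normSqOnLine t s x ≤ normSqOnLine t s 0 := by
  have hden : 0 < 2 - t - s := by linarith [ht.2, hs.2]
  have hnum : (2 - t - s) ^ 2 ≤ (2 - t + s) ^ 2 := by gcongr 1; linarith [hs.1]
  have hblaschke : (x ^ 2 + (2 - t + s) ^ 2) / (x ^ 2 + (2 - t - s) ^ 2) ≤
      (0 ^ 2 + (2 - t + s) ^ 2) / (0 ^ 2 + (2 - t - s) ^ 2) := by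
    rw [div_le_div_iff₀ (by positivity) (by positivity)]
    linarith [mul_le_mul_of_nonneg_left hnum (sq_nonneg x)]
  unfold normSqOnLine
  gcongr
  exact rePhase_le_rePhase_zero ⟨ht.1, by linarith [ht.2]⟩ hs x

lemma normSqOnLine_zero (t s : ℝ) :
    normSqOnLine t s 0 = ((2 - t + s) / (2 - t - s) * Real.exp (rePhase t s 0)) ^ 2 := by
  rw [normSqOnLine, mul_pow, div_pow, ← Real.exp_nat_mul]
  norm_num

lemma onLine_neg (h : ℂ → ℂ) (s x : ℝ) : onLine h (-s) x = h (x - Complex.I * s) := by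
  rw [onLine, Complex.ofReal_neg, mul_neg, sub_eq_add_neg]

lemma norm_blaschke_sq (γ s x : ℝ) :
    ‖blaschke γ (x - Complex.I * s)‖ ^ 2 =
      (x ^ 2 + (2 - 2 / γ + s) ^ 2) / (x ^ 2 + (2 - 2 / γ - s) ^ 2) := by
  rw [blaschke, blaschkeZero, Complex.sq_norm, Complex.normSq_div, Complex.normSq_apply,
    Complex.normSq_apply]
  simp only [map_mul, Complex.conj_I, Complex.conj_ofReal, Complex.sub_re, Complex.sub_im,
    Complex.mul_re, Complex.mul_im, Complex.neg_re, Complex.neg_im, Complex.I_re, Complex.I_im,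
    Complex.ofReal_re, Complex.ofReal_im]
  congr 1 <;> ring

lemma norm_onLine_optimizer_sq {γ s : ℝ} (hγ : 1 ≤ γ) (hs : |s| ≤ 1) (x : ℝ) :
    ‖onLine (optimizer γ) (-s) x‖ ^ 2 = normSqOnLine (2 / γ) s x := by
  rw [onLine_neg, optimizer, norm_mul, mul_pow, norm_blaschke_sq, Complex.norm_exp,
    phase_eq hγ ((abs_im_sub_I_mul x s).trans_le hs),
    re_I_mul_halfLinePhase (two_div_mem_Icc hγ) hs, ← Real.exp_nat_mul, Nat.cast_ofNat,
    normSqOnLine]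

lemma two_div_mem_Ioo {γ : ℝ} (hγ : 2 < γ) : 2 / γ ∈ Ioo (0 : ℝ) 1 :=
  ⟨by positivity, (div_lt_one (by positivity)).2 hγ⟩

section

variable {γ s : ℝ} (hγ : 2 < γ)
include hγ

lemma continuousOn_blaschke : ContinuousOn (blaschke γ) {z | |z.im| ≤ 1} := by
  refine ContinuousOn.div (by fun_prop) (by fun_prop) fun z (hz : |z.im| ≤ 1) h0 => ?_
  have him := congrArg Complex.im h0
  simp only [blaschkeZero, Complex.sub_im, map_mul, Complex.conj_I, Complex.conj_ofReal,
    Complex.mul_im, Complex.neg_re, Complex.neg_im, Complex.I_re, Complex.I_im,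
    Complex.ofReal_re, Complex.ofReal_im, Complex.zero_im] at him
  linarith [(abs_le.1 hz).1, (two_div_mem_Ioo hγ).2]

lemma continuousOn_optimizer : ContinuousOn (optimizer γ) {z | |z.im| ≤ 1} := by
  have hmaps : MapsTo (fun z : ℂ => (2 / γ, z)) {z | |z.im| ≤ 1}
      (Icc 0 2 ×ˢ {z | |z.im| ≤ 1}) := fun z hz => ⟨two_div_mem_Icc (by linarith), hz⟩
  have hphase : ContinuousOn (phase γ) {z | |z.im| ≤ 1} :=
    (continuousOn_const.mul (continuousOn_halfLinePhase.comp (by fun_prop) hmaps)).congr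
      fun z hz => phase_eq (by linarith) hz
  exact (continuousOn_blaschke hγ).mul hphase.cexp

variable (hs : s ∈ Icc (0 : ℝ) 1)
include hs

lemma continuous_onLine_optimizer : Continuous (onLine (optimizer γ) (-s)) :=
  (continuousOn_optimizer hγ).comp_continuous (by fun_prop) fun x => by
    simpa [abs_of_nonneg hs.1] using hs.2

lemma norm_onLine_optimizer_le_zero (x : ℝ) :
    ‖onLine (optimizer γ) (-s) x‖ ≤ ‖onLine (optimizer γ) (-s) 0‖ := by
  have hs' : |s| ≤ 1 := (abs_of_nonneg hs.1).trans_le hs.2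
  refine le_of_sq_le_sq ?_ (norm_nonneg _)
  rw [norm_onLine_optimizer_sq (by linarith) hs', norm_onLine_optimizer_sq (by linarith) hs']
  exact normSqOnLine_le_normSqOnLine_zero (Ioo_subset_Ico_self (two_div_mem_Ioo hγ)) hs x

lemma norm_onLine_optimizer_zero : ‖onLine (optimizer γ) (-s) 0‖ =
    (2 - 2 / γ + s) / (2 - 2 / γ - s) * Real.exp (rePhase (2 / γ) s 0) := by
  have hnum : 0 ≤ 2 - 2 / γ + s := by linarith [(two_div_mem_Ioo hγ).2, hs.1]
  have hden : 0 ≤ 2 - 2 / γ - s := by linarith [(two_div_mem_Ioo hγ).2, hs.2]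
  refine (pow_left_inj₀ (norm_nonneg _) (by positivity) two_ne_zero).1 ?_
  rw [norm_onLine_optimizer_sq (by linarith) ((abs_of_nonneg hs.1).trans_le hs.2),
    normSqOnLine_zero]

lemma norm_onLine_optimizer_le (x : ℝ) :
    ‖onLine (optimizer γ) (-s) x‖ ≤ 3 / (1 - 2 / γ) * Real.exp 96 := by
  obtain ⟨ht₀, ht₁⟩ := two_div_mem_Ioo hγ
  have : 0 < 1 - 2 / γ := by linarith
  have hs' : |s| ≤ 1 := (abs_of_nonneg hs.1).trans_le hs.2
  have hphase : rePhase (2 / γ) s 0 ≤ 96 := calc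
    rePhase (2 / γ) s 0 ≤ 96 * |s| ^ 3 :=
      (le_abs_self _).trans (abs_rePhase_zero_le ⟨ht₀.le, by linarith⟩ hs')
    _ ≤ 96 := mul_le_of_le_one_right (by norm_num) (pow_le_one₀ (abs_nonneg s) hs')
  refine (norm_onLine_optimizer_le_zero hγ hs x).trans ?_
  rw [norm_onLine_optimizer_zero hγ hs]
  have hnum : 2 - 2 / γ + s ≤ 3 := by linarith [hs.2]
  have hden : 1 - 2 / γ ≤ 2 - 2 / γ - s := by linarith [hs.2]
  gcongr

lemma isBoundaryValue_optimizer :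
    IsBoundaryValue (optimizer γ) (-s) (onLine (optimizer γ) (-s)) := by
  intro φ
  have hmem {y : ℝ} (hy : y ∈ Ioo (-1 : ℝ) 0) : -y ∈ Icc (0 : ℝ) 1 :=
    ⟨by linarith [hy.2], by linarith [hy.1]⟩
  refine tendsto_integral_filter_of_dominated_convergence
    (fun x => 3 / (1 - 2 / γ) * Real.exp 96 * ‖φ x‖) ?_ ?_ (φ.integrable.norm.const_mul _)
    (Eventually.of_forall fun x => Tendsto.mul_const _ ?_)
  · filter_upwards [self_mem_nhdsWithin] with y hy
    have hcont := continuous_onLine_optimizer hγ (hmem hy)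
    rw [neg_neg] at hcont
    exact (hcont.mul φ.continuous).aestronglyMeasurable
  · filter_upwards [self_mem_nhdsWithin] with y hy
    refine Eventually.of_forall fun x => ?_
    have hle := norm_onLine_optimizer_le hγ (hmem hy) x
    rw [neg_neg] at hle
    rw [norm_mul]
    gcongr
  · have hvertical : ContinuousOn (fun y : ℝ => onLine (optimizer γ) y x) {y | |y| ≤ 1} :=
      (continuousOn_optimizer hγ).comp (by fun_prop) fun y hy => by simpa using hy
    exact (hvertical (-s) (by simpa [abs_of_nonneg hs.1] using hs.2)).mono
      fun y hy => abs_le.2 ⟨hy.1.le, hy.2.le.trans zero_le_one⟩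

lemma memLp_top_onLine_optimizer : MemLp (onLine (optimizer γ) (-s)) ∞ volume :=
  memLp_top_of_bound (continuous_onLine_optimizer hγ hs).aestronglyMeasurable _
    (Eventually.of_forall (norm_onLine_optimizer_le hγ hs))

end

lemma lpNormReal_top_eq_of_forall_le {f : ℝ → ℂ} (hf : Continuous f) {x₀ : ℝ}
    (hle : ∀ x, ‖f x‖ ≤ ‖f x₀‖) : lpNormReal ∞ f = ‖f x₀‖ := by
  have hupper : eLpNormEssSup f volume ≤ ‖f x₀‖ₑ :=
    eLpNormEssSup_le_of_ae_enorm_bound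
      (Eventually.of_forall fun x => enorm_le_iff_norm_le.2 (hle x))
  have hlower : ‖f x₀‖ₑ ≤ eLpNormEssSup f volume := by
    have hclosed : IsClosed {x : ℝ | ‖f x‖ₑ ≤ eLpNormEssSup f volume} :=
      isClosed_le hf.enorm continuous_const
    have hdense : Dense {x : ℝ | ‖f x‖ₑ ≤ eLpNormEssSup f volume} :=
      Measure.dense_of_ae (ae_le_eLpNormEssSup (f := f) (μ := volume))
    exact hclosed.closure_subset (hdense x₀)
  rw [lpNormReal, eLpNorm_exponent_top, le_antisymm hupper hlower, toReal_enorm]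

lemma lpNormReal_top_onLine_optimizer {γ s : ℝ} (hγ : 2 < γ) (hs : s ∈ Icc (0 : ℝ) 1) :
    lpNormReal ∞ (onLine (optimizer γ) (-s)) =
      (2 - 2 / γ + s) / (2 - 2 / γ - s) * Real.exp (rePhase (2 / γ) s 0) := by
  rw [lpNormReal_top_eq_of_forall_le (continuous_onLine_optimizer hγ hs)
    (norm_onLine_optimizer_le_zero hγ hs), norm_onLine_optimizer_zero hγ hs]

/-! ### The `L²` norm on the lower line -/

/-- `‖h_{-1}‖₂²` as a function of `t = 2 / γ`. -/
def lowerLineNormSq (t : ℝ) : ℝ := ∫ x : ℝ, normSqOnLine t 1 x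

lemma normSqOnLine_one (t x : ℝ) :
    normSqOnLine t 1 x =
      (x ^ 2 + (3 - t) ^ 2) * Real.exp (2 * rePhase t 1 x) / (x ^ 2 + (1 - t) ^ 2) := by
  rw [normSqOnLine]
  ring_nf

lemma sq_add_sq_mul_exp_rePhase_le {t : ℝ} (ht : t ∈ Icc (0 : ℝ) 1) (x : ℝ) :
    (x ^ 2 + (3 - t) ^ 2) * Real.exp (2 * rePhase t 1 x) ≤ 9 * Real.exp 192 := by
  have hnum : x ^ 2 + (3 - t) ^ 2 ≤ 9 * (1 + x ^ 2 / 4) ^ 2 := by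
    nlinarith [sq_nonneg x, sq_nonneg (x ^ 2), ht.1, ht.2]
  calc (x ^ 2 + (3 - t) ^ 2) * Real.exp (2 * rePhase t 1 x)
      ≤ 9 * (1 + x ^ 2 / 4) ^ 2 * (Real.exp 192 / (1 + x ^ 2 / 4) ^ 2) := by
        gcongr
        exact exp_two_mul_rePhase_one_le ⟨ht.1, by linarith [ht.2]⟩ x
    _ = 9 * Real.exp 192 := by field_simp

lemma continuous_rePhase_one {t : ℝ} (ht : t ∈ Icc (0 : ℝ) 1) : Continuous (rePhase t 1) :=
  continuousOn_rePhase.comp_continuous (f := fun x => (t, 1, x)) (by fun_prop)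
    fun x => ⟨⟨ht.1, by linarith [ht.2]⟩, (abs_one.le : |(1 : ℝ)| ≤ 1), mem_univ x⟩

section

variable {t : ℝ} (ht : t ∈ Ico (0 : ℝ) 1)
include ht

lemma normSqOnLine_one_le (x : ℝ) :
    normSqOnLine t 1 x ≤ 9 * Real.exp 192 / (1 - t) ^ 2 * (1 + x ^ 2)⁻¹ := by
  have hδ : 0 < 1 - t := by linarith [ht.2]
  have hden : (1 - t) ^ 2 * (1 + x ^ 2) ≤ x ^ 2 + (1 - t) ^ 2 := by
    nlinarith [mul_nonneg (mul_nonneg ht.1 (by linarith [ht.2] : 0 ≤ 2 - t)) (sq_nonneg x)]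
  rw [normSqOnLine_one, ← div_eq_mul_inv, div_div]
  gcongr ?_ / ?_
  exact sq_add_sq_mul_exp_rePhase_le (Ico_subset_Icc_self ht) x

lemma continuous_normSqOnLine_one : Continuous (normSqOnLine t 1) := by
  have hden (x : ℝ) : x ^ 2 + (1 - t) ^ 2 ≠ 0 := by
    have : 0 < 1 - t := by linarith [ht.2]
    positivity
  have hphase := continuous_rePhase_one (Ico_subset_Icc_self ht)
  simp only [funext (normSqOnLine_one t)]
  fun_prop (disch := exact hden _)

lemma integrable_normSqOnLine_one : Integrable (normSqOnLine t 1) := by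
  refine (integrable_inv_one_add_sq.const_mul (9 * Real.exp 192 / (1 - t) ^ 2)).mono'
    (continuous_normSqOnLine_one ht).aestronglyMeasurable (Eventually.of_forall fun x => ?_)
  rw [Real.norm_of_nonneg (normSqOnLine_nonneg t 1 x)]
  exact normSqOnLine_one_le ht x

end

lemma memLp_two_onLine_optimizer {γ : ℝ} (hγ : 2 < γ) :
    MemLp (onLine (optimizer γ) (-1)) 2 volume := by
  rw [memLp_two_iff_integrable_sq_norm
    (continuous_onLine_optimizer hγ ⟨zero_le_one, le_rfl⟩).aestronglyMeasurable]
  simp only [norm_onLine_optimizer_sq (by linarith : 1 ≤ γ) (abs_one.le : |(1 : ℝ)| ≤ 1)]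
  exact integrable_normSqOnLine_one (Ioo_subset_Ico_self (two_div_mem_Ioo hγ))

lemma lpNormReal_two_sq {f : ℝ → ℂ} (hf : MemLp f 2 volume) :
    lpNormReal 2 f ^ 2 = ∫ x, ‖f x‖ ^ 2 := by
  rw [lpNormReal, hf.eLpNorm_eq_integral_rpow_norm two_ne_zero (by simp),
    ENNReal.toReal_ofReal (by positivity)]
  simp only [ENNReal.toReal_ofNat, Real.rpow_two]
  rw [← Real.rpow_mul_natCast (by positivity)]
  norm_num

lemma lpNormReal_two_onLine_optimizer_sq {γ : ℝ} (hγ : 2 < γ) :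
    lpNormReal 2 (onLine (optimizer γ) (-1)) ^ 2 = lowerLineNormSq (2 / γ) := by
  simp only [lpNormReal_two_sq (memLp_two_onLine_optimizer hγ), lowerLineNormSq,
    norm_onLine_optimizer_sq (by linarith : 1 ≤ γ) (abs_one.le : |(1 : ℝ)| ≤ 1)]

lemma threeLinesRatio_optimizer {γ : ℝ} (hγ : 2 < γ) :
    threeLinesRatio γ (optimizer γ) =
      (1 - 2 / γ) ^ (-γ) * Real.exp (γ * rePhase (2 / γ) (2 / γ) 0) /
        lowerLineNormSq (2 / γ) := by
  obtain ⟨ht₀, ht₁⟩ := two_div_mem_Ioo hγ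
  have hδ : 0 < 1 - 2 / γ := by linarith
  have hupper : lpNormReal ∞ (onLine (optimizer γ) 0) = 1 := by
    have hphase : rePhase (2 / γ) 0 0 = 0 := by simp [rePhase, rePhaseIntegrand]
    have h := lpNormReal_top_onLine_optimizer hγ (left_mem_Icc.2 zero_le_one)
    rwa [neg_zero, hphase, Real.exp_zero, mul_one, add_zero, sub_zero,
      div_self (by linarith)] at h
  have hmiddle : lpNormReal ∞ (onLine (optimizer γ) (-(2 / γ))) =
      (1 - 2 / γ)⁻¹ * Real.exp (rePhase (2 / γ) (2 / γ) 0) := by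
    rw [lpNormReal_top_onLine_optimizer hγ ⟨ht₀.le, ht₁.le⟩, sub_add_cancel,
      show 2 - 2 / γ - 2 / γ = 2 * (1 - 2 / γ) by ring]
    field_simp
  rw [threeLinesRatio, hupper, hmiddle, Real.one_rpow, one_mul,
    lpNormReal_two_onLine_optimizer_sq hγ, Real.mul_rpow (by positivity) (by positivity),
    Real.inv_rpow hδ.le, ← Real.rpow_neg hδ.le, ← Real.exp_mul, mul_comm γ]

/-! ### Hyperbolic expansions and the integrals they evaluate -/

lemma integral_eq_of_hasSum_of_nonneg {α : Type*} [MeasurableSpace α] {μ : Measure α}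
    {f : ℕ → α → ℝ} {g : α → ℝ} {L : ℝ} (hint : ∀ n, Integrable (f n) μ)
    (hnonneg : ∀ n, 0 ≤ᵐ[μ] f n)
    (hL : Tendsto (fun N => ∑ n ∈ Finset.range N, ∫ a, f n a ∂μ) atTop (𝓝 L))
    (hg : ∀ᵐ a ∂μ, HasSum (fun n => f n a) (g a)) : ∫ a, g a ∂μ = L := by
  have hsum : HasSum (fun n => ∫ a, f n a ∂μ) L :=
    (hasSum_iff_tendsto_nat_of_nonneg (fun n => integral_nonneg_of_ae (hnonneg n)) L).2 hL
  have hnorm (n : ℕ) : ∫ a, f n a ∂μ = ∫ a, ‖f n a‖ ∂μ :=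
    integral_congr_ae ((hnonneg n).mono fun _ ha => (Real.norm_of_nonneg ha).symm)
  rw [← (hasSum_integral_of_summable_integral_norm hint (hsum.summable.congr hnorm)).unique hsum]
  exact integral_congr_ae (hg.mono fun _ ha => ha.tsum_eq.symm)

lemma tendsto_euler_sinh_prod (x : ℝ) :
    Tendsto (fun n : ℕ => Real.pi * x * ∏ j ∈ Finset.range n, (1 + x ^ 2 / ((j : ℝ) + 1) ^ 2))
      atTop (𝓝 (Real.sinh (Real.pi * x))) := by
  have hsin : (Complex.sin (Real.pi * (x * Complex.I))).im = Real.sinh (Real.pi * x) := by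
    rw [← mul_assoc, ← Complex.ofReal_mul, Complex.sin_mul_I, Complex.mul_I_im,
      ← Complex.ofReal_sinh, Complex.ofReal_re]
  have hprod (n : ℕ) : Real.pi * (x * Complex.I) *
      ∏ j ∈ Finset.range n, (1 - (x * Complex.I) ^ 2 / ((j : ℂ) + 1) ^ 2) =
      ((Real.pi * x * ∏ j ∈ Finset.range n, (1 + x ^ 2 / ((j : ℝ) + 1) ^ 2) : ℝ) : ℂ) *
        Complex.I := by
    push_cast
    simp only [mul_pow, Complex.I_sq, mul_neg, mul_one, neg_div, sub_neg_eq_add]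
    ring
  have hlim := (Complex.continuous_im.tendsto _).comp
    (Complex.tendsto_euler_sin_prod (x * Complex.I))
  rw [hsin] at hlim
  refine hlim.congr fun n => ?_
  rw [Function.comp_apply, hprod, Complex.mul_I_im, Complex.ofReal_re]

lemma prod_range_two_mul_one_add_sq_div (x : ℝ) (n : ℕ) :
    ∏ j ∈ Finset.range (2 * n), (1 + x ^ 2 / ((j : ℝ) + 1) ^ 2) =
      (∏ j ∈ Finset.range n, (1 + x ^ 2 / (2 * (j : ℝ) + 1) ^ 2)) *
        ∏ j ∈ Finset.range n, (1 + (x / 2) ^ 2 / ((j : ℝ) + 1) ^ 2) := by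
  induction n with
  | zero => simp
  | succ n ih =>
    have hodd : x ^ 2 / (((2 * n + 1 : ℕ) : ℝ) + 1) ^ 2 = (x / 2) ^ 2 / ((n : ℝ) + 1) ^ 2 := by
      push_cast
      field_simp
      ring
    rw [show 2 * (n + 1) = 2 * n + 1 + 1 by ring, Finset.prod_range_succ, Finset.prod_range_succ,
      ih, Finset.prod_range_succ, Finset.prod_range_succ, hodd]
    push_cast
    ring

lemma tendsto_euler_cosh_prod (x : ℝ) :
    Tendsto (fun n : ℕ => ∏ j ∈ Finset.range n, (1 + x ^ 2 / (2 * (j : ℝ) + 1) ^ 2)) atTop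
      (𝓝 (Real.cosh (Real.pi * x / 2))) := by
  rcases eq_or_ne x 0 with rfl | hx
  · simp
  have hpi := Real.pi_ne_zero
  have hsinh : Real.sinh (Real.pi * (x / 2)) ≠ 0 := Real.sinh_ne_zero.2 (by positivity)
  have hquot := (((tendsto_euler_sinh_prod x).comp
    (tendsto_id.const_mul_atTop' two_pos)).div (tendsto_euler_sinh_prod (x / 2)) hsinh).div_const 2
  have hcosh : Real.sinh (Real.pi * x) / Real.sinh (Real.pi * (x / 2)) / 2 =
      Real.cosh (Real.pi * x / 2) := by
    rw [show Real.pi * x = 2 * (Real.pi * (x / 2)) by ring, Real.sinh_two_mul]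
    field_simp
  rw [hcosh] at hquot
  refine hquot.congr fun n => ?_
  have : ∏ j ∈ Finset.range n, (1 + (x / 2) ^ 2 / ((j : ℝ) + 1) ^ 2) ≠ 0 :=
    (Finset.prod_pos fun j _ => by positivity).ne'
  simp only [Function.comp_apply, id, Pi.div_apply, prod_range_two_mul_one_add_sq_div]
  field_simp

lemma one_sub_exp_neg_two_mul (k : ℝ) :
    1 - Real.exp (-2 * k) = 2 * Real.exp (-k) * Real.sinh k := by
  rw [Real.sinh_eq, show -2 * k = -k + -k by ring, Real.exp_add, Real.exp_neg]
  field_simp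

section

variable {k : ℝ} (hk : 0 < k)
include hk

lemma hasSum_inv_sinh :
    HasSum (fun n : ℕ => 2 * Real.exp (-(2 * n + 1) * k)) (Real.sinh k)⁻¹ := by
  have hgeom := (hasSum_geometric_of_lt_one (Real.exp_pos (-2 * k)).le
    (Real.exp_lt_one_iff.2 (by linarith))).mul_left (2 * Real.exp (-k))
  have hsum : 2 * Real.exp (-k) * (1 - Real.exp (-2 * k))⁻¹ = (Real.sinh k)⁻¹ := by
    rw [one_sub_exp_neg_two_mul, mul_inv, mul_inv_cancel_left₀ (by positivity)]
  rw [hsum] at hgeom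
  refine hgeom.congr_fun fun n => ?_
  rw [← Real.exp_nat_mul, mul_assoc, ← Real.exp_add]
  ring_nf

lemma hasSum_inv_sinh_sq :
    HasSum (fun n : ℕ => 4 * ((n : ℝ) + 1) * Real.exp (-(2 * ((n : ℝ) + 1)) * k))
      (Real.sinh k ^ 2)⁻¹ := by
  have hq : ‖Real.exp (-2 * k)‖ < 1 := by
    rw [Real.norm_of_nonneg (Real.exp_pos _).le, Real.exp_lt_one_iff]
    linarith
  have hgeom : HasSum (fun n : ℕ => ((n + 1 : ℕ) : ℝ) * Real.exp (-2 * k) ^ (n + 1))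
      (Real.exp (-2 * k) / (1 - Real.exp (-2 * k)) ^ 2) := by
    have hgeom₀ := hasSum_coe_mul_geometric_of_norm_lt_one (r := Real.exp (-2 * k)) hq
    simpa only [Finset.sum_range_one, Nat.cast_zero, zero_mul, sub_zero] using
      (hasSum_nat_add_iff' 1).2 hgeom₀
  have hsum : 4 * (Real.exp (-2 * k) / (1 - Real.exp (-2 * k)) ^ 2) = (Real.sinh k ^ 2)⁻¹ := by
    have : 0 < Real.sinh k := Real.sinh_pos_iff.2 hk
    rw [one_sub_exp_neg_two_mul, show -2 * k = -k + -k by ring, Real.exp_add]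
    field_simp
    norm_num
  rw [← hsum]
  refine (hgeom.mul_left 4).congr_fun fun n => ?_
  rw [← Real.exp_nat_mul, Nat.cast_add_one, ← mul_assoc]
  ring_nf

end

lemma integral_inv_sinh_mul_one_sub_cos_div (x : ℝ) :
    ∫ k in Ioi (0 : ℝ), (Real.sinh k)⁻¹ * ((1 - Real.cos (x * k)) / k) =
      Real.log (Real.cosh (Real.pi * x / 2)) := by
  have hc (n : ℕ) : (0 : ℝ) < 2 * n + 1 := by positivity
  refine integral_eq_of_hasSum_of_nonneg
    (f := fun n k => 2 * (Real.exp (-(2 * n + 1) * k) * ((1 - Real.cos (x * k)) / k)))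
    (fun n => (integrableOn_exp_mul_one_sub_cos_div (hc n) x).const_mul 2)
    (fun n => ae_restrict_of_forall_mem measurableSet_Ioi fun k hk => ?_) ?_
    (ae_restrict_of_forall_mem measurableSet_Ioi fun k hk => ?_)
  · have := one_sub_cos_div_nonneg x (le_of_lt hk)
    positivity
  · have hlog := ((Real.continuousAt_log (Real.cosh_pos (Real.pi * x / 2)).ne').tendsto).comp
      (tendsto_euler_cosh_prod x)
    refine hlog.congr fun N => ?_
    rw [Function.comp_apply, Real.log_prod fun j _ => by positivity]
    refine Finset.sum_congr rfl fun n _ => ?_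
    rw [integral_const_mul, integral_exp_mul_one_sub_cos_div (hc n),
      mul_div_cancel₀ _ two_ne_zero]
  · simpa only [mul_assoc] using
      (hasSum_inv_sinh hk).mul_right ((1 - Real.cos (x * k)) / k)

lemma sum_range_log_eq (N : ℕ) :
    ∑ n ∈ Finset.range N, (2 * ((n : ℝ) + 1) *
      (Real.log (2 * ((n : ℝ) + 1) + 1) - Real.log (2 * ((n : ℝ) + 1) - 1)) - 2) =
    2 * N * Real.log (2 * N + 1) - 2 * Real.log ((2 * N).factorial) + 2 * N * Real.log 2 +
      2 * Real.log (N.factorial) - 2 * N := by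
  induction N with
  | zero => simp
  | succ N ih =>
    have hN : (N : ℝ) + 1 ≠ 0 := by positivity
    have hfact : (N.factorial : ℝ) ≠ 0 := Nat.cast_ne_zero.2 N.factorial_ne_zero
    have hfact₂ : ((2 * N).factorial : ℝ) ≠ 0 := Nat.cast_ne_zero.2 (2 * N).factorial_ne_zero
    rw [Finset.sum_range_succ, ih, show 2 * (N + 1) = 2 * N + 1 + 1 by ring, Nat.factorial_succ,
      Nat.factorial_succ, Nat.factorial_succ]
    push_cast
    rw [show 2 * (N : ℝ) + 1 + 1 = 2 * (N + 1) by ring,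
      Real.log_mul (by positivity) (by positivity), Real.log_mul two_ne_zero hN,
      Real.log_mul (by positivity) hfact₂, Real.log_mul hN hfact,
      show 2 * ((N : ℝ) + 1) - 1 = 2 * N + 1 by ring]
    ring

lemma tendsto_sum_range_log :
    Tendsto (fun N : ℕ => ∑ n ∈ Finset.range N, (2 * ((n : ℝ) + 1) *
      (Real.log (2 * ((n : ℝ) + 1) + 1) - Real.log (2 * ((n : ℝ) + 1) - 1)) - 2)) atTop
      (𝓝 (1 - Real.log 2)) := by
  have htwo : Tendsto (fun N : ℕ => 2 * N) atTop atTop := tendsto_id.const_mul_atTop' two_pos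
  have hstirling : Tendsto (fun N => Real.log (Stirling.stirlingSeq N)) atTop
      (𝓝 (Real.log √Real.pi)) :=
    Stirling.tendsto_stirlingSeq_sqrt_pi.log (Real.sqrt_ne_zero'.2 Real.pi_pos)
  have hlog : Tendsto (fun N : ℕ => ((2 * N : ℕ) : ℝ) * Real.log (1 + 1 / ((2 * N : ℕ) : ℝ)))
      atTop (𝓝 1) :=
    (Real.tendsto_mul_log_one_add_div_atTop 1).comp (tendsto_natCast_atTop_atTop.comp htwo)
  have hlim := (hlog.add ((hstirling.sub (hstirling.comp htwo)).const_mul 2)).sub_const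
    (Real.log 2)
  simp only [sub_self, mul_zero, add_zero] at hlim
  refine hlim.congr' ?_
  filter_upwards [eventually_gt_atTop 0] with N hN
  have hN' : (0 : ℝ) < N := Nat.cast_pos.2 hN
  rw [sum_range_log_eq, Function.comp_apply, Stirling.log_stirlingSeq_formula,
    Stirling.log_stirlingSeq_formula]
  push_cast
  rw [show 1 + 1 / (2 * (N : ℝ)) = (2 * N + 1) / (2 * N) by field_simp,
    Real.log_div (by positivity) (by positivity), Real.log_div (by positivity) (by positivity),
    Real.log_div (by positivity) (by positivity), Real.log_exp,
    Real.log_mul two_ne_zero (by positivity : (2 * (N : ℝ)) ≠ 0),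
    Real.log_mul two_ne_zero hN'.ne']
  ring

lemma integral_inv_sinh_sq_mul_sinh_div_sub_one :
    ∫ k in Ioi (0 : ℝ), (Real.sinh k ^ 2)⁻¹ * (Real.sinh k / k - 1) = 1 - Real.log 2 := by
  have hm (n : ℕ) : (1 : ℝ) < 2 * ((n : ℝ) + 1) := by linarith [n.cast_nonneg (α := ℝ)]
  refine integral_eq_of_hasSum_of_nonneg
    (f := fun n k => 4 * ((n : ℝ) + 1) *
      (Real.exp (-(2 * ((n : ℝ) + 1)) * k) * (Real.sinh k / k - 1)))
    (fun n => (integrableOn_exp_mul_sinh_div_sub_one (hm n)).const_mul _)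
    (fun n => ae_restrict_of_forall_mem measurableSet_Ioi fun k (hk : 0 < k) => ?_) ?_
    (ae_restrict_of_forall_mem measurableSet_Ioi fun k hk => ?_)
  · have : 0 ≤ Real.sinh k / k - 1 := by
      rw [sub_nonneg, one_le_div hk]
      exact Real.self_le_sinh_iff.2 hk.le
    positivity
  · refine tendsto_sum_range_log.congr fun N => Finset.sum_congr rfl fun n _ => ?_
    rw [integral_const_mul, integral_exp_mul_sinh_div_sub_one (hm n)]
    field_simp
    ring
  · simpa only [mul_assoc] using (hasSum_inv_sinh_sq hk).mul_right (Real.sinh k / k - 1)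

/-! ### The limit integrand in closed form -/

lemma halfLineWeight_zero_left (k : ℝ) :
    halfLineWeight 0 k = 2 - 4 * Real.exp (-2 * k) * Real.sinh k ^ 2 := by
  have hsq : 4 * Real.exp (-2 * k) * Real.sinh k ^ 2 = (1 - Real.exp (-2 * k)) ^ 2 := by
    rw [one_sub_exp_neg_two_mul, show -2 * k = -k + -k by ring, Real.exp_add]
    ring
  rw [hsq, halfLineWeight, show -(4 - 0) * k = -2 * k + -2 * k by ring, Real.exp_add, sub_zero,
    neg_zero, zero_mul, Real.exp_zero]
  ring

lemma halfLineWeight_zero_div {k : ℝ} (hk : k ≠ 0) :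
    halfLineWeight 0 k / (2 * Real.sinh k) =
      (Real.sinh k)⁻¹ - Real.exp (-1 * k) + Real.exp (-3 * k) := by
  have hsinh : Real.sinh k ≠ 0 := Real.sinh_ne_zero.2 hk
  have hexp : 2 * Real.exp (-2 * k) * Real.sinh k = Real.exp (-1 * k) - Real.exp (-3 * k) := by
    rw [Real.sinh_eq, show -1 * k = -2 * k + k by ring, show -3 * k = -2 * k + -k by ring,
      Real.exp_add, Real.exp_add]
    ring
  rw [sub_add, ← hexp, halfLineWeight_zero_left]
  field_simp
  ring

lemma rePhase_zero_one_zero_sub (x : ℝ) :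
    rePhase 0 1 0 - rePhase 0 1 x = Real.log (Real.cosh (Real.pi * x / 2)) -
      Real.log (1 + x ^ 2) / 2 + Real.log (1 + x ^ 2 / 9) / 2 := by
  have ht : (0 : ℝ) ∈ Icc (0 : ℝ) 2 := ⟨le_rfl, zero_le_two⟩
  have hphase := integrableOn_halfLineWeight_div_mul_one_sub_cos ht x
  have hone := integrableOn_exp_mul_one_sub_cos_div one_pos x
  have hthree := integrableOn_exp_mul_one_sub_cos_div three_pos x
  have hsum : IntegrableOn (fun k =>
      halfLineWeight 0 k / (2 * Real.sinh k) * ((1 - Real.cos (x * k)) / k) +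
        Real.exp (-1 * k) * ((1 - Real.cos (x * k)) / k)) (Ioi 0) := hphase.add hone
  have hsplit := integral_inv_sinh_mul_one_sub_cos_div x
  rw [setIntegral_congr_fun (g := fun k =>
      halfLineWeight 0 k / (2 * Real.sinh k) * ((1 - Real.cos (x * k)) / k) +
        Real.exp (-1 * k) * ((1 - Real.cos (x * k)) / k) -
        Real.exp (-3 * k) * ((1 - Real.cos (x * k)) / k)) measurableSet_Ioi
      fun k (hk : 0 < k) => by
        simp only [halfLineWeight_zero_div hk.ne']
        ring,
    integral_sub hsum hthree, integral_add hphase hone, ← rePhase_one_zero_sub ht,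
    integral_exp_mul_one_sub_cos_div one_pos, integral_exp_mul_one_sub_cos_div three_pos] at hsplit
  norm_num at hsplit ⊢
  linarith

lemma rePhase_zero_one_zero : rePhase 0 1 0 = 2 - Real.log 6 := by
  have hphase : IntegrableOn (rePhaseIntegrand 0 1 0) (Ioi 0) :=
    integrableOn_rePhaseIntegrand (by simp) (by simp) 0
  have htwo := (integrableOn_exp_mul_sinh_div_sub_one one_lt_two).const_mul 2
  have hsplit := integral_inv_sinh_sq_mul_sinh_div_sub_one
  rw [setIntegral_congr_fun (g := fun k => rePhaseIntegrand 0 1 0 k +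
      2 * (Real.exp (-2 * k) * (Real.sinh k / k - 1))) measurableSet_Ioi
      fun k (hk : 0 < k) => by
        have : 0 < Real.sinh k := Real.sinh_pos_iff.2 hk
        simp only [rePhaseIntegrand, halfLineWeight_zero_left, cosh_two_mul_sub_one, zero_mul,
          Real.cos_zero, one_mul]
        field_simp
        ring,
    integral_add hphase htwo, integral_const_mul, integral_exp_mul_sinh_div_sub_one one_lt_two]
    at hsplit
  have hlog : Real.log 6 = Real.log 2 + Real.log 3 := by
    rw [← Real.log_mul two_ne_zero three_ne_zero]
    norm_num
  norm_num at hsplit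
  rw [rePhase]
  linarith

lemma limitIntegrand_eq_normSqOnLine : limitIntegrand = normSqOnLine 0 1 := by
  funext x
  rw [limitIntegrand, normSqOnLine, rePhaseInfty_eq]
  norm_num

lemma limitIntegrand_eq_inv_cosh_sq (x : ℝ) :
    limitIntegrand x = Real.exp 4 / 4 * (Real.cosh (Real.pi / 2 * x) ^ 2)⁻¹ := by
  have hcosh := Real.cosh_pos (Real.pi * x / 2)
  have hphase : 2 * rePhaseInfty x = 4 - (2 : ℕ) * Real.log 6 -
      (2 : ℕ) * Real.log (Real.cosh (Real.pi * x / 2)) +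
      Real.log (1 + x ^ 2) - Real.log (1 + x ^ 2 / 9) := by
    have hsub := rePhase_zero_one_zero_sub x
    rw [rePhase_zero_one_zero, ← rePhaseInfty_eq] at hsub
    push_cast
    linarith
  rw [limitIntegrand, hphase, Real.exp_sub, Real.exp_add, Real.exp_sub, Real.exp_sub,
    Real.exp_nat_mul, Real.exp_nat_mul, Real.exp_log (by norm_num), Real.exp_log hcosh,
    Real.exp_log (by positivity), Real.exp_log (by positivity), div_mul_eq_mul_div Real.pi]
  field_simp
  ring

lemma integrable_limitIntegrand : Integrable limitIntegrand := by
  rw [limitIntegrand_eq_normSqOnLine]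
  exact integrable_normSqOnLine_one ⟨le_rfl, zero_lt_one⟩

lemma hasDerivAt_neg_two_div_exp_add_one (x : ℝ) :
    HasDerivAt (fun x => -2 / (Real.exp (2 * x) + 1)) (Real.cosh x ^ 2)⁻¹ x := by
  have hexp : HasDerivAt (fun x => Real.exp (2 * x) + 1) (Real.exp (2 * x) * (2 * 1)) x :=
    ((hasDerivAt_id x).const_mul 2).exp.add_const 1
  have hcosh : Real.exp (2 * x) + 1 = 2 * Real.exp x * Real.cosh x := by
    rw [Real.cosh_eq, two_mul x, Real.exp_add, Real.exp_neg]
    field_simp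
  refine ((hasDerivAt_const x (-2)).div hexp (by positivity)).congr_deriv ?_
  have := Real.cosh_pos x
  rw [hcosh, two_mul x, Real.exp_add]
  field_simp
  ring

lemma integrable_inv_cosh_sq : Integrable fun x : ℝ => (Real.cosh x ^ 2)⁻¹ := by
  have hcont : Continuous fun x : ℝ => (Real.cosh x ^ 2)⁻¹ :=
    (Real.continuous_cosh.pow 2).inv₀ fun x => (pow_pos (Real.cosh_pos x) 2).ne'
  refine integrable_inv_one_add_sq.mono' hcont.aestronglyMeasurable
    (Eventually.of_forall fun x => ?_)
  have hsinh : x ^ 2 ≤ Real.sinh x ^ 2 := sq_le_sq.2 <| by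
    rw [Real.abs_sinh]
    exact Real.self_le_sinh_iff.2 (abs_nonneg x)
  rw [Real.norm_of_nonneg (by positivity), Real.cosh_sq']
  gcongr

lemma integral_inv_cosh_sq : ∫ x : ℝ, (Real.cosh x ^ 2)⁻¹ = 2 := by
  have htop : Tendsto (fun x : ℝ => -2 / (Real.exp (2 * x) + 1)) atTop (𝓝 0) :=
    ((Real.tendsto_exp_atTop.comp (tendsto_id.const_mul_atTop two_pos)).atTop_add
      tendsto_const_nhds).const_div_atTop _
  have hbot : Tendsto (fun x : ℝ => -2 / (Real.exp (2 * x) + 1)) atBot (𝓝 (-2 / (0 + 1))) :=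
    tendsto_const_nhds.div ((Real.tendsto_exp_atBot.comp
      (tendsto_id.const_mul_atBot two_pos)).add_const 1) (by norm_num)
  rw [integral_of_hasDerivAt_of_tendsto hasDerivAt_neg_two_div_exp_add_one integrable_inv_cosh_sq
    hbot htop]
  norm_num

lemma integral_limitIntegrand : ∫ x, limitIntegrand x = Real.exp 4 / Real.pi := by
  simp only [limitIntegrand_eq_inv_cosh_sq]
  rw [integral_const_mul,
    Measure.integral_comp_mul_left (fun x => (Real.cosh x ^ 2)⁻¹) (Real.pi / 2),
    integral_inv_cosh_sq, abs_of_pos (by positivity), smul_eq_mul]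
  field_simp
  norm_num

lemma limitValue_eq : limitValue = 4 * Real.pi ^ 2 / Real.exp 2 := by
  rw [limitValue, integral_limitIntegrand, show (4 : ℝ) = 2 + 2 by norm_num, Real.exp_add]
  field_simp

lemma abs_limitValue_sub_lt : |limitValue - 5.342823| < 5 / 10 ^ 7 := by
  have hexp : Real.exp 2 = Real.exp 1 ^ 2 := by
    rw [← Real.exp_nat_mul]
    norm_num
  have hpi_gt : (3.141592653 : ℝ) ^ 2 ≤ Real.pi ^ 2 := by
    gcongr
    linarith [Real.pi_gt_d20]
  have hpi_lt : Real.pi ^ 2 ≤ (3.141592654 : ℝ) ^ 2 := by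
    gcongr
    linarith [Real.pi_lt_d20]
  have hexp_gt : (2.7182818283 : ℝ) ^ 2 ≤ Real.exp 1 ^ 2 := by
    gcongr
    exact Real.exp_one_gt_d9.le
  have hexp_lt : Real.exp 1 ^ 2 ≤ (2.7182818286 : ℝ) ^ 2 := by
    gcongr
    exact Real.exp_one_lt_d9.le
  rw [limitValue_eq, hexp, abs_lt, lt_sub_iff_add_lt, sub_lt_iff_lt_add,
    lt_div_iff₀ (by positivity), div_lt_iff₀ (by positivity)]
  constructor <;> linarith

/-! ### The two limits -/

lemma tendsto_rePhase {ι : Type*} {l : Filter ι} {t s x : ι → ℝ} {t₀ s₀ x₀ : ℝ}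
    (ht : Tendsto t l (𝓝 t₀)) (hs : Tendsto s l (𝓝 s₀)) (hx : Tendsto x l (𝓝 x₀))
    (htl : ∀ᶠ i in l, t i ∈ Icc 0 2) (hsl : ∀ᶠ i in l, |s i| ≤ 1)
    (ht₀ : t₀ ∈ Icc 0 2) (hs₀ : |s₀| ≤ 1) :
    Tendsto (fun i => rePhase (t i) (s i) (x i)) l (𝓝 (rePhase t₀ s₀ x₀)) := by
  have hcont : Tendsto (fun p : ℝ × ℝ × ℝ => rePhase p.1 p.2.1 p.2.2)
      (𝓝[Icc 0 2 ×ˢ {s | |s| ≤ 1} ×ˢ univ] (t₀, s₀, x₀)) (𝓝 (rePhase t₀ s₀ x₀)) :=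
    (continuousOn_rePhase (t₀, s₀, x₀) ⟨ht₀, hs₀, mem_univ x₀⟩).tendsto
  have hpair : Tendsto (fun i => (t i, s i, x i)) l
      (𝓝[Icc 0 2 ×ˢ {s | |s| ≤ 1} ×ˢ univ] (t₀, s₀, x₀)) :=
    tendsto_nhdsWithin_iff.2 ⟨ht.prodMk_nhds (hs.prodMk_nhds hx),
      (htl.and hsl).mono fun _ hi => ⟨hi.1, hi.2, mem_univ _⟩⟩
  simpa only [Function.comp_def] using hcont.comp hpair

lemma tendsto_normSqOnLine_one (x : ℝ) :
    Tendsto (fun t => normSqOnLine t 1 x) (𝓝[>] 0) (𝓝 (normSqOnLine 0 1 x)) := by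
  have hid : Tendsto (fun t : ℝ => t) (𝓝[>] 0) (𝓝 0) := nhdsWithin_le_nhds
  have hphase : Tendsto (fun t => rePhase t 1 x) (𝓝[>] 0) (𝓝 (rePhase 0 1 x)) :=
    tendsto_rePhase hid tendsto_const_nhds tendsto_const_nhds
      (mem_of_superset (Ioo_mem_nhdsGT two_pos) Ioo_subset_Icc_self) (by simp)
      (by simp) (by simp)
  simp only [normSqOnLine_one]
  exact ((((hid.const_sub 3).pow 2).const_add (x ^ 2)).mul (hphase.const_mul 2).rexp).div
    (((hid.const_sub 1).pow 2).const_add (x ^ 2)) (by positivity)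

lemma tendsto_lowerLineNormSq_zero :
    Tendsto lowerLineNormSq (𝓝[>] 0) (𝓝 (lowerLineNormSq 0)) := by
  have hsmall : ∀ᶠ t : ℝ in 𝓝[>] 0, t ∈ Ioo (0 : ℝ) (1 / 2) := Ioo_mem_nhdsGT (by norm_num)
  refine tendsto_integral_filter_of_dominated_convergence
    (fun x => 9 * Real.exp 192 / (1 / 2) ^ 2 * (1 + x ^ 2)⁻¹) ?_ ?_
    (integrable_inv_one_add_sq.const_mul _) (Eventually.of_forall tendsto_normSqOnLine_one)
  · filter_upwards [hsmall] with t ht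
    exact (continuous_normSqOnLine_one ⟨ht.1.le, by linarith [ht.2]⟩).aestronglyMeasurable
  · filter_upwards [hsmall] with t ht
    refine Eventually.of_forall fun x => ?_
    rw [Real.norm_of_nonneg (normSqOnLine_nonneg t 1 x)]
    refine (normSqOnLine_one_le ⟨ht.1.le, by linarith [ht.2]⟩ x).trans ?_
    gcongr
    linarith [ht.2]

lemma one_sub_mul_lowerLineNormSq {t : ℝ} (ht : t < 1) :
    (1 - t) * lowerLineNormSq t = ∫ u : ℝ, (((1 - t) * u) ^ 2 + (3 - t) ^ 2) *
      Real.exp (2 * rePhase t 1 ((1 - t) * u)) * (1 + u ^ 2)⁻¹ := by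
  have hδ : 0 < 1 - t := sub_pos.2 ht
  have hscale := Measure.integral_comp_mul_left (normSqOnLine t 1) (1 - t)
  rw [abs_of_pos (inv_pos.2 hδ), smul_eq_mul, inv_mul_eq_div, eq_div_iff hδ.ne'] at hscale
  rw [lowerLineNormSq, ← hscale, mul_left_comm, ← sq, ← integral_mul_const]
  refine integral_congr_ae (Eventually.of_forall fun u => ?_)
  simp only [normSqOnLine_one]
  rw [show ((1 - t) * u) ^ 2 + (1 - t) ^ 2 = (1 - t) ^ 2 * (1 + u ^ 2) by ring]
  field_simp

-- With `x = (1 - t) u` the Lorentzian `(1 - t) / (x² + (1 - t)²)` becomes `1 / (1 + u²)`.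
lemma tendsto_one_sub_mul_lowerLineNormSq :
    Tendsto (fun t => (1 - t) * lowerLineNormSq t) (𝓝[<] 1)
      (𝓝 (4 * Real.pi * Real.exp (2 * rePhase 1 1 0))) := by
  have hlt : ∀ᶠ t : ℝ in 𝓝[<] 1, t ∈ Ioo (0 : ℝ) 1 := Ioo_mem_nhdsLT one_pos
  have hid : Tendsto (fun t : ℝ => t) (𝓝[<] 1) (𝓝 1) := nhdsWithin_le_nhds
  have hlim : 4 * Real.pi * Real.exp (2 * rePhase 1 1 0) =
      ∫ u : ℝ, ((0 * u) ^ 2 + 2 ^ 2) * Real.exp (2 * rePhase 1 1 (0 * u)) * (1 + u ^ 2)⁻¹ := by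
    simp only [zero_mul]
    rw [integral_const_mul, integral_univ_inv_one_add_sq]
    ring
  rw [hlim]
  refine Tendsto.congr' (hlt.mono fun t ht => (one_sub_mul_lowerLineNormSq ht.2).symm) ?_
  refine tendsto_integral_filter_of_dominated_convergence
    (fun u => 9 * Real.exp 192 * (1 + u ^ 2)⁻¹) ?_ ?_ (integrable_inv_one_add_sq.const_mul _)
    (Eventually.of_forall fun u => ?_)
  · filter_upwards [hlt] with t ht
    have hphase := continuous_rePhase_one (Ioo_subset_Icc_self ht)
    have hden (u : ℝ) : 1 + u ^ 2 ≠ 0 := by positivity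
    exact (by fun_prop (disch := exact hden _) : Continuous fun u : ℝ =>
      (((1 - t) * u) ^ 2 + (3 - t) ^ 2) * Real.exp (2 * rePhase t 1 ((1 - t) * u)) *
        (1 + u ^ 2)⁻¹).aestronglyMeasurable
  · filter_upwards [hlt] with t ht
    refine Eventually.of_forall fun u => ?_
    rw [Real.norm_of_nonneg (by positivity)]
    exact mul_le_mul_of_nonneg_right
      (sq_add_sq_mul_exp_rePhase_le (Ioo_subset_Icc_self ht) _) (by positivity)
  · have hx : Tendsto (fun t : ℝ => (1 - t) * u) (𝓝[<] 1) (𝓝 (0 * u)) := by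
      simpa only [sub_self] using (hid.const_sub 1).mul_const u
    have hthree : Tendsto (fun t : ℝ => 3 - t) (𝓝[<] 1) (𝓝 2) := by
      simpa only [show (3 : ℝ) - 1 = 2 by norm_num] using hid.const_sub 3
    have hphase := tendsto_rePhase hid (tendsto_const_nhds (x := (1 : ℝ))) hx
      (hlt.mono fun t ht => ⟨ht.1.le, by linarith [ht.2]⟩) (by simp) (by norm_num) (by simp)
    exact (((hx.pow 2).add (hthree.pow 2)).mul (hphase.const_mul 2).rexp).mul_const _

lemma tendsto_mul_rePhase_atTop :
    Tendsto (fun γ : ℝ => γ * rePhase (2 / γ) (2 / γ) 0) atTop (𝓝 0) := by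
  have hbound : Tendsto (fun γ : ℝ => 768 / γ ^ 2) atTop (𝓝 0) :=
    tendsto_const_nhds.div_atTop (tendsto_pow_atTop two_ne_zero)
  refine squeeze_zero_norm' ?_ hbound
  filter_upwards [eventually_gt_atTop 2] with γ hγ
  obtain ⟨ht₀, ht₁⟩ := two_div_mem_Ioo hγ
  have hγ₀ : 0 < γ := by linarith
  have hphase := abs_rePhase_zero_le (t := 2 / γ) (s := 2 / γ) ⟨ht₀.le, by linarith⟩
    ((abs_of_pos ht₀).trans_le ht₁.le)
  rw [abs_of_pos ht₀] at hphase
  rw [norm_mul, Real.norm_of_nonneg hγ₀.le, Real.norm_eq_abs]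
  calc γ * |rePhase (2 / γ) (2 / γ) 0| ≤ γ * (96 * (2 / γ) ^ 3) := by gcongr
    _ = 768 / γ ^ 2 := by
      field_simp
      norm_num

lemma tendsto_one_sub_two_div_rpow_neg_atTop :
    Tendsto (fun γ : ℝ => (1 - 2 / γ) ^ (-γ)) atTop (𝓝 (Real.exp 2)) := by
  have h := (Real.tendsto_one_add_div_rpow_exp (-2)).inv₀ (Real.exp_pos _).ne'
  rw [Real.exp_neg, inv_inv] at h
  refine h.congr' ?_
  filter_upwards [eventually_gt_atTop 2] with γ hγ
  rw [Real.rpow_neg (by linarith [(two_div_mem_Ioo hγ).2]), neg_div, ← sub_eq_add_neg]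

lemma tendsto_threeLinesRatio_atTop :
    Tendsto (fun γ : ℝ => 4 * Real.pi * threeLinesRatio γ (optimizer γ)) atTop
      (𝓝 limitValue) := by
  have ht : Tendsto (fun γ : ℝ => 2 / γ) atTop (𝓝[>] 0) :=
    tendsto_nhdsWithin_iff.2 ⟨tendsto_const_nhds.div_atTop tendsto_id,
      (eventually_gt_atTop 0).mono fun γ hγ => div_pos two_pos hγ⟩
  have hzero : lowerLineNormSq 0 = ∫ x, limitIntegrand x := by
    rw [lowerLineNormSq, limitIntegrand_eq_normSqOnLine]
  have hne : lowerLineNormSq 0 ≠ 0 := by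
    rw [hzero, integral_limitIntegrand]
    positivity
  have hlim := ((tendsto_one_sub_two_div_rpow_neg_atTop.mul tendsto_mul_rePhase_atTop.rexp).div
    (tendsto_lowerLineNormSq_zero.comp ht) hne).const_mul (4 * Real.pi)
  rw [Real.exp_zero, mul_one, hzero, ← mul_div_assoc, div_eq_mul_inv (4 * Real.pi * Real.exp 2),
    ← limitValue] at hlim
  refine hlim.congr' ?_
  filter_upwards [eventually_gt_atTop 2] with γ hγ
  rw [threeLinesRatio_optimizer hγ]
  rfl

lemma tendsto_two_div_nhdsGT_two : Tendsto (fun γ : ℝ => 2 / γ) (𝓝[>] 2) (𝓝[<] 1) := by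
  have hid : Tendsto (fun γ : ℝ => γ) (𝓝[>] 2) (𝓝 2) := nhdsWithin_le_nhds
  refine tendsto_nhdsWithin_iff.2 ⟨?_, ?_⟩
  · simpa only [div_self (two_ne_zero' ℝ), Pi.div_def] using
      (tendsto_const_nhds (x := 2)).div hid two_ne_zero
  · filter_upwards [self_mem_nhdsWithin] with γ hγ
    exact (two_div_mem_Ioo hγ).2

lemma tendsto_mul_rePhase_nhdsGT_two :
    Tendsto (fun γ : ℝ => γ * rePhase (2 / γ) (2 / γ) 0) (𝓝[>] 2)
      (𝓝 (2 * rePhase 1 1 0)) := by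
  have ht := tendsto_two_div_nhdsGT_two.mono_right nhdsWithin_le_nhds
  have hid : Tendsto (fun γ : ℝ => γ) (𝓝[>] 2) (𝓝 2) := nhdsWithin_le_nhds
  have hmem : ∀ᶠ γ : ℝ in 𝓝[>] 2, 2 / γ ∈ Ioo (0 : ℝ) 1 :=
    eventually_nhdsWithin_of_forall fun γ hγ => two_div_mem_Ioo hγ
  exact hid.mul (tendsto_rePhase ht ht tendsto_const_nhds
    (hmem.mono fun γ hγ => ⟨hγ.1.le, by linarith [hγ.2]⟩)
    (hmem.mono fun γ hγ => (abs_of_pos hγ.1).trans_le hγ.2.le) (by norm_num) (by simp))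

lemma exp_log_one_sub_two_div_mul {γ : ℝ} (hγ : 2 < γ) :
    Real.exp (Real.log (1 - 2 / γ) * (1 - 2 / γ) * (-(γ / 2))) =
      (1 - 2 / γ) * ((γ - 2) ^ (γ / 2) / γ ^ (γ / 2)) * (1 - 2 / γ) ^ (-γ) := by
  have hδ : 0 < 1 - 2 / γ := sub_pos.2 (two_div_mem_Ioo hγ).2
  have hdiv : (γ - 2) ^ (γ / 2) / γ ^ (γ / 2) = (1 - 2 / γ) ^ (γ / 2) := by
    rw [← Real.div_rpow (by linarith) (by linarith), sub_div, div_self (by linarith)]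
  rw [hdiv, ← Real.rpow_one_add' hδ.le (by linarith), ← Real.rpow_add hδ, Real.rpow_def_of_pos hδ]
  congr 1
  field_simp
  ring

lemma tendsto_one_sub_two_div_mul_rpow_nhdsGT_two :
    Tendsto (fun γ : ℝ =>
      (1 - 2 / γ) * ((γ - 2) ^ (γ / 2) / γ ^ (γ / 2)) * (1 - 2 / γ) ^ (-γ)) (𝓝[>] 2) (𝓝 1) := by
  have hid : Tendsto (fun γ : ℝ => γ) (𝓝[>] 2) (𝓝 2) := nhdsWithin_le_nhds
  have hδ : Tendsto (fun γ : ℝ => 1 - 2 / γ) (𝓝[>] 2) (𝓝[>] 0) := by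
    refine tendsto_nhdsWithin_iff.2 ⟨?_, ?_⟩
    · simpa only [sub_self] using
        (tendsto_two_div_nhdsGT_two.mono_right nhdsWithin_le_nhds).const_sub 1
    · filter_upwards [self_mem_nhdsWithin] with γ hγ
      exact sub_pos.2 (two_div_mem_Ioo hγ).2
  have hlog : Tendsto (fun δ : ℝ => Real.log δ * δ) (𝓝[>] 0) (𝓝 0) := by
    simpa only [Real.rpow_one] using tendsto_log_mul_rpow_nhdsGT_zero one_pos
  have hexp := ((hlog.comp hδ).mul (hid.div_const 2).neg).rexp
  rw [zero_mul, Real.exp_zero] at hexp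
  refine hexp.congr' ?_
  filter_upwards [self_mem_nhdsWithin] with γ hγ
  exact exp_log_one_sub_two_div_mul hγ

lemma tendsto_threeLinesRatio_nhdsGT_two :
    Tendsto (fun γ : ℝ => 4 * Real.pi * (γ - 2) ^ (γ / 2) / γ ^ (γ / 2) *
      threeLinesRatio γ (optimizer γ)) (𝓝[>] 2) (𝓝 1) := by
  have hlim := ((tendsto_one_sub_two_div_mul_rpow_nhdsGT_two.mul
    tendsto_mul_rePhase_nhdsGT_two.rexp).div
    (tendsto_one_sub_mul_lowerLineNormSq.comp tendsto_two_div_nhdsGT_two)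
    (by positivity)).const_mul (4 * Real.pi)
  rw [one_mul, ← mul_div_assoc, div_self (by positivity)] at hlim
  refine hlim.congr' ?_
  filter_upwards [self_mem_nhdsWithin] with γ hγ
  have hδ : 0 < 1 - 2 / γ := sub_pos.2 (two_div_mem_Ioo hγ).2
  rw [threeLinesRatio_optimizer hγ, Pi.div_apply, Function.comp_apply]
  field_simp

end ThreeLines

end

theorem lemma5p1 :
    -- the principal value defining the phase exists on the closed lower strip, the restrictions
    -- of the optimizer to `Im z = 0` and `Im z = -1` are its boundary values, and the three
    -- norms in the ratio are finite
    (∀ γ : ℝ, 2 < γ →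
      (∀ z : ℂ, -1 ≤ z.im → z.im ≤ 0 →
        (∀ ε : ℝ, 0 < ε →
          IntegrableOn (ThreeLines.phaseIntegrand γ z) {k : ℝ | ε ≤ |k|} volume) ∧
        Tendsto (ThreeLines.truncatedPhase γ z) (𝓝[>] (0 : ℝ)) (𝓝 (ThreeLines.phase γ z))) ∧
      ThreeLines.IsBoundaryValue (ThreeLines.optimizer γ) 0
        (ThreeLines.onLine (ThreeLines.optimizer γ) 0) ∧
      ThreeLines.IsBoundaryValue (ThreeLines.optimizer γ) (-1)
        (ThreeLines.onLine (ThreeLines.optimizer γ) (-1)) ∧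
      MemLp (ThreeLines.onLine (ThreeLines.optimizer γ) (-(2 / γ))) ∞ volume ∧
      MemLp (ThreeLines.onLine (ThreeLines.optimizer γ) 0) ∞ volume ∧
      MemLp (ThreeLines.onLine (ThreeLines.optimizer γ) (-1)) 2 volume) ∧
    -- the limit `γ ↓ 2`
    Tendsto (fun γ : ℝ => 4 * Real.pi * (γ - 2) ^ (γ / 2) / γ ^ (γ / 2) *
        ThreeLines.threeLinesRatio γ (ThreeLines.optimizer γ))
      (𝓝[>] (2 : ℝ)) (𝓝 1) ∧
    -- the integrals in the limit value converge
    (∀ x : ℝ, IntegrableOn (ThreeLines.rePhaseInftyIntegrand x) (Set.Ioi (0 : ℝ)) volume) ∧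
    Integrable ThreeLines.limitIntegrand volume ∧
    -- the limit `γ → ∞`
    Tendsto (fun γ : ℝ => 4 * Real.pi *
        ThreeLines.threeLinesRatio γ (ThreeLines.optimizer γ))
      atTop (𝓝 ThreeLines.limitValue) ∧
    -- its numerical value, correct to six decimals
    |ThreeLines.limitValue - 5.342823| < 5 / 10 ^ 7 := by
  refine ⟨fun γ hγ => ⟨fun z hz_ge hz_le => ?_, ?_, ?_, ?_, ?_, ?_⟩,
    ThreeLines.tendsto_threeLinesRatio_nhdsGT_two, ThreeLines.integrableOn_rePhaseInftyIntegrand,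
    ThreeLines.integrable_limitIntegrand, ThreeLines.tendsto_threeLinesRatio_atTop,
    ThreeLines.abs_limitValue_sub_lt⟩
  · have hγ' : 1 ≤ γ := by linarith
    have hz : |z.im| ≤ 1 := abs_le.2 ⟨hz_ge, hz_le.trans zero_le_one⟩
    exact ⟨fun ε hε => ThreeLines.integrableOn_phaseIntegrand hγ' hz hε,
      ThreeLines.tendsto_truncatedPhase hγ' hz⟩
  · simpa only [neg_zero] using ThreeLines.isBoundaryValue_optimizer hγ ⟨le_rfl, zero_le_one⟩
  · exact ThreeLines.isBoundaryValue_optimizer hγ ⟨zero_le_one, le_rfl⟩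
  · exact ThreeLines.memLp_top_onLine_optimizer hγ
      (Set.Ioo_subset_Icc_self (ThreeLines.two_div_mem_Ioo hγ))
  · simpa only [neg_zero] using ThreeLines.memLp_top_onLine_optimizer hγ ⟨le_rfl, zero_le_one⟩
  · exact ThreeLines.memLp_two_onLine_optimizer hγ
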